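/- Let $\mathbf{k}$ be an algebraically closed field of characteristic zero. Let $N=\mathbb{Z}^n$, let $N^\vee\cong\mathbb{Z}^n$ be the dual lattice with pairing $\langle\cdot,\cdot\rangle$, let $\Delta_{\mathbb{Q}}\subset N_{\mathbb{Q}}$ be a full-dimensional strongly convex polyhedral cone with ray generators $\rho_1,\dots,\rho_r$ (the primitive lattice vectors on its extremal rays), and let $\Delta^\vee\subset N^\vee$ be the monoid of lattice points of the dual cone. Let $X=\operatorname{Spec}\bigoplus_{m\in\Delta^\vee}\mathbf{k}\chi^m$ be the corresponding normal affine toric variety without torus factor. Let $e_1,e_2\in N^\vee$ be Demazure roots associated with the two different ray generators $\rho_1$ and $\rho_2$; that is, for $j=1,2$, $\langle\rho_j,e_j\rangle=-1$ and $\langle\rho_i,e_j\rangle\ge 0$ for all $i\ne j$. (The numbering is only a convenience: the two distinct ray generators may be arbitrary.) Let $\partial_j\in\operatorname{Der}\mathcal{O}(X)$ be the root derivation $\chi^m\mapsto\langle\rho_j,m\rangle\chi^{m+e_j}$, let $U_j=\{\exp(t\partial_j)\mid t\in\mathbf{k}\}$, let $H=\langle U_1,U_2\rangle\subset\operatorname{Aut}(X)$,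 and let $L$ be the Lie algebra over $\mathbf{k}$ generated by $\partial_1,\partial_2$. Put $c=\langle\rho_2,e_1\rangle$ and $d=\langle\rho_1,e_2\rangle$. Let $\mathbf{k}[x_1,\dots,x_r]$ be the Cox ring of $X$, let $\hat\rho_1,\dots,\hat\rho_r$ be the standard basis of $\mathbb{Z}^r$, and let $\hat e_j=(\langle\rho_i,e_j\rangle)_{i=1,\dots,r}\in\mathbb{Z}^r$. Let $\hat\partial_j$ be the lifted root derivations $$\hat\partial_1=x_2^cN_1\,\partial/\partial x_1,\qquad \hat\partial_2=x_1^dN_2\,\partial/\partial x_2,\qquad N_j=\prod_{i\ge 3}x_i^{\langle\rho_i,e_j\rangle}.$$ Let $\hat U_j=\{\exp(t\hat\partial_j)\mid t\in\mathbf{k}\}$, let $\hat H=\langle\hat U_1,\hat U_2\rangle\subset\operatorname{Aut}(\mathbb{A}^r)$, and let $\hat L$ be the Lie algebra over $\mathbf{k}$ generated by $\hat\partial_1,\hat\partial_2$. A group of automorphisms of an affine variety is called a unipotent algebraic group if it is the isomorphic image of a unipotent linear algebraic group (a Zariski closed subgroup of some $GL_m(\mathbf{k})$ consisting of unipotent matrices)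 acting regularly on the variety. Then the following conditions are equivalent: (i) $\hat H$ is a unipotent algebraic group; (ii) $\hat L$ is finite-dimensional and nilpotent; (iii) $\min\{\langle\hat\rho_1,\hat e_2\rangle,\langle\hat\rho_2,\hat e_1\rangle\}=\min\{c,d\}=0$. Likewise, the following conditions are equivalent: (i') $H$ is a unipotent algebraic group; (ii') $L$ is finite-dimensional and nilpotent; (iii') $\min\{\langle\rho_1,e_2\rangle,\langle\rho_2,e_1\rangle\}=0$. -/

import Mathlib

namespace RootSubgroups

section Exponential

variable {k : Type*} [Field k] {A : Type*} [CommRing A] [Algebra k A]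

/-- A derivation is locally nilpotent if every element is killed by some power of it. -/
def IsLocallyNilpotent (D : Derivation k A A) : Prop :=
  ∀ f : A, ∃ N : ℕ, D^[N] f = 0

/-- The exponential series `∑ i, D^i f / i!`; for a locally nilpotent derivation the sum is finite. -/
noncomputable def expFun (D : Derivation k A A) (f : A) : A :=
  ∑ᶠ i : ℕ, ((i.factorial : k)⁻¹) • D^[i] f

theorem iterate_zero_of_le (D : Derivation k A A) {f : A} {N i : ℕ} (h : D^[N] f = 0)
    (hi : N ≤ i) : D^[i] f = 0 := by
  obtain ⟨j, rfl⟩ := Nat.exists_eq_add_of_le' hi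
  rw [Function.iterate_add_apply, h]
  exact iterate_map_zero D j

theorem iterate_smul' (D : Derivation k A A) (c : k) (f : A) (i : ℕ) :
    D^[i] (c • f) = c • D^[i] f := by
  induction i with
  | zero => rfl
  | succ i ih => rw [Function.iterate_succ_apply', ih, D.map_smul, Function.iterate_succ_apply']

theorem smul_iterate (D : Derivation k A A) (c : k) (f : A) (i : ℕ) :
    (c • D)^[i] f = c ^ i • D^[i] f := by
  induction i with
  | zero => simp
  | succ i ih =>
    rw [Function.iterate_succ_apply', ih, Derivation.smul_apply, D.map_smul,
      Function.iterate_succ_apply', smul_smul, pow_succ']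

theorem expFun_eq_sum (D : Derivation k A A) {f : A} {N : ℕ} (h : D^[N] f = 0) :
    expFun D f = ∑ i ∈ Finset.range N, ((i.factorial : k)⁻¹) • D^[i] f := by
  refine finsum_eq_sum_of_support_subset _ fun i hi => ?_
  by_contra hcon
  apply hi
  have : N ≤ i := by simpa using hcon
  simp [iterate_zero_of_le D h this]

theorem sum_sum_eq_sum_antidiagonal {M : Type*} [AddCommMonoid M] (F : ℕ → ℕ → M) (N : ℕ)
    (hF : ∀ i j, N ≤ i + j → F i j = 0) (a b : ℕ) (ha : ∀ i j, a ≤ i → F i j = 0)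
    (hb : ∀ i j, b ≤ j → F i j = 0) :
    ∑ i ∈ Finset.range a, ∑ j ∈ Finset.range b, F i j =
      ∑ n ∈ Finset.range N, ∑ p ∈ Finset.HasAntidiagonal.antidiagonal n, F p.1 p.2 := by
  rw [← Finset.sum_product', Finset.sum_sigma']
  refine Finset.sum_bij_ne_zero (fun p _ _ => ⟨p.1 + p.2, p⟩) ?_ ?_ ?_ ?_
  · intro p _ hp
    simp only [Finset.mem_sigma, Finset.mem_range, Finset.HasAntidiagonal.mem_antidiagonal, and_true]
    by_contra h
    exact hp (hF _ _ (not_lt.mp h))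
  · intro p _ _ q _ _ h
    simp only [Sigma.mk.injEq] at h
    exact eq_of_heq h.2
  · rintro ⟨n, p⟩ hp hne
    simp only [Finset.mem_sigma, Finset.mem_range, Finset.HasAntidiagonal.mem_antidiagonal] at hp
    refine ⟨p, ?_, hne, ?_⟩
    · simp only [Finset.mem_product, Finset.mem_range]
      exact ⟨by by_contra h; exact hne (ha _ _ (not_lt.mp h)),
        by by_contra h; exact hne (hb _ _ (not_lt.mp h))⟩
    · obtain ⟨_, rfl⟩ := hp
      rfl
  · intros; rfl

theorem iterate_mul' (D : Derivation k A A) (f g : A) (n : ℕ) :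
    D^[n] (f * g) =
      ∑ p ∈ Finset.HasAntidiagonal.antidiagonal n, (n.choose p.1) • (D^[p.1] f * D^[p.2] g) := by
  induction n with
  | zero => simp
  | succ n ih =>
    rw [Finset.sum_antidiagonal_choose_succ_nsmul (fun i j => D^[i] f * D^[j] g) n,
      Function.iterate_succ_apply', ih, map_sum, ← Finset.sum_add_distrib]
    refine Finset.sum_congr rfl fun p hp => ?_
    have hc : n.choose p.2 = n.choose p.1 :=
      (Nat.choose_symm_of_eq_add (Finset.HasAntidiagonal.mem_antidiagonal.mp hp).symm).symm
    simp only [map_nsmul, Derivation.leibniz, smul_eq_mul, Function.iterate_succ_apply']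
    rw [hc, ← smul_add, mul_comm (D^[p.2] g)]


theorem expFun_mul [CharZero k] (D : Derivation k A A) (hD : IsLocallyNilpotent D) (f g : A) :
    expFun D (f * g) = expFun D f * expFun D g := by
  obtain ⟨a, ha⟩ := hD f
  obtain ⟨b, hb⟩ := hD g
  have hz : ∀ i j, a + b ≤ i + j → D^[i] f * D^[j] g = 0 := by
    intro i j hij
    rcases le_or_gt a i with h | h
    · rw [iterate_zero_of_le D ha h, zero_mul]
    · rw [iterate_zero_of_le D hb (by omega : b ≤ j), mul_zero]
  have hab : D^[a + b] (f * g) = 0 := by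
    rw [iterate_mul']
    refine Finset.sum_eq_zero fun p hp => ?_
    rw [hz _ _ (Finset.HasAntidiagonal.mem_antidiagonal.mp hp).ge, smul_zero]
  rw [expFun_eq_sum D ha, expFun_eq_sum D hb, expFun_eq_sum D hab, Finset.sum_mul_sum,
    sum_sum_eq_sum_antidiagonal _ (a + b)]
  · refine Finset.sum_congr rfl fun n _ => ?_
    rw [iterate_mul', Finset.smul_sum]
    refine Finset.sum_congr rfl fun p hp => ?_
    obtain rfl := Finset.HasAntidiagonal.mem_antidiagonal.mp hp
    rw [← Nat.cast_smul_eq_nsmul k, smul_smul, smul_mul_smul_comm, Nat.cast_add_choose]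
    congr 1
    have h0 : ((p.1 + p.2).factorial : k) ≠ 0 := by exact_mod_cast Nat.factorial_ne_zero _
    field_simp
  · intro i j hij
    rw [smul_mul_smul_comm, hz i j hij, smul_zero]
  · intro i j hij
    rw [iterate_zero_of_le D ha hij, smul_zero, zero_mul]
  · intro i j hij
    rw [iterate_zero_of_le D hb hij, smul_zero, mul_zero]

theorem expFun_add (D : Derivation k A A) (hD : IsLocallyNilpotent D) (f g : A) :
    expFun D (f + g) = expFun D f + expFun D g := by
  obtain ⟨a, ha⟩ := hD f
  obtain ⟨b, hb⟩ := hD g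
  have ha' := iterate_zero_of_le D ha (le_max_left a b)
  have hb' := iterate_zero_of_le D hb (le_max_right a b)
  have hab : D^[max a b] (f + g) = 0 := by rw [iterate_map_add, ha', hb', add_zero]
  rw [expFun_eq_sum D ha', expFun_eq_sum D hb', expFun_eq_sum D hab, ← Finset.sum_add_distrib]
  refine Finset.sum_congr rfl fun i _ => ?_
  rw [iterate_map_add, smul_add]

theorem expFun_algebraMap (D : Derivation k A A) (c : k) :
    expFun D (algebraMap k A c) = algebraMap k A c := by
  rw [expFun_eq_sum D (N := 1) (by simp)]
  simp

theorem IsLocallyNilpotent.smul {D : Derivation k A A} (hD : IsLocallyNilpotent D) (c : k) :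
    IsLocallyNilpotent (c • D) := fun f => by
  obtain ⟨N, hN⟩ := hD f
  exact ⟨N, by rw [smul_iterate, hN, smul_zero]⟩

theorem expFun_neg_expFun [CharZero k] (D : Derivation k A A) (hD : IsLocallyNilpotent D) (f : A) :
    expFun ((-1 : k) • D) (expFun D f) = f := by
  obtain ⟨a, ha⟩ := hD f
  have key : ∀ i, ((-1 : k) • D)^[i] (expFun D f) =
      ∑ j ∈ Finset.range a, ((-1) ^ i * ((j.factorial : k)⁻¹)) • D^[i + j] f := by
    intro i
    rw [smul_iterate, expFun_eq_sum D ha]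
    have : ∀ s : Finset ℕ, D^[i] (∑ j ∈ s, ((j.factorial : k)⁻¹) • D^[j] f) =
        ∑ j ∈ s, ((j.factorial : k)⁻¹) • D^[i + j] f := by
      intro s
      induction s using Finset.induction_on with
      | empty => simp
      | insert j s hj ih =>
        rw [Finset.sum_insert hj, Finset.sum_insert hj, iterate_map_add, ih, iterate_smul',
          ← Function.iterate_add_apply]
    rw [this, Finset.smul_sum]
    simp only [smul_smul]
  have h0 : ((-1 : k) • D)^[a] (expFun D f) = 0 := by
    rw [key]
    refine Finset.sum_eq_zero fun j _ => ?_
    rw [iterate_zero_of_le D ha (by omega), smul_zero]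
  rw [expFun_eq_sum _ h0]
  simp only [key, Finset.smul_sum, smul_smul]
  rw [sum_sum_eq_sum_antidiagonal _ (a + 1)]
  · rw [Finset.sum_range_succ', Finset.sum_eq_zero]
    · simp
    · intro n _
      have : ∀ p ∈ Finset.HasAntidiagonal.antidiagonal (n + 1),
          ((p.1.factorial : k)⁻¹ * ((-1) ^ p.1 * (p.2.factorial : k)⁻¹)) • D^[p.1 + p.2] f =
          (((n + 1).factorial : k)⁻¹ * ((-1) ^ p.1 * 1 ^ p.2 * ((n + 1).choose p.1 : k))) •
            D^[n + 1] f := by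
        intro p hp
        rw [← Finset.HasAntidiagonal.mem_antidiagonal.mp hp, Nat.cast_add_choose]
        congr 1
        have h0 : ((p.1 + p.2).factorial : k) ≠ 0 := by exact_mod_cast Nat.factorial_ne_zero _
        field_simp
        simp
      rw [Finset.sum_congr rfl this, ← Finset.sum_smul, ← Finset.mul_sum]
      have h2 := (Commute.all (-1 : k) 1).add_pow' (n + 1)
      simp only [nsmul_eq_mul] at h2
      have h3 : ∑ p ∈ Finset.HasAntidiagonal.antidiagonal (n + 1),
          ((-1 : k) ^ p.1 * 1 ^ p.2 * ((n + 1).choose p.1 : k)) = 0 := by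
        rw [Finset.sum_congr rfl (fun p _ => mul_comm _ _), ← h2]
        simp
      rw [h3, mul_zero, zero_smul]
  · intro i j hij
    rw [iterate_zero_of_le D ha (by omega), smul_zero]
  · intro i j hij
    rw [iterate_zero_of_le D ha (by omega), smul_zero]
  · intro i j hij
    rw [iterate_zero_of_le D ha (by omega), smul_zero]

/-- The automorphism `exp D = ∑ i, D^i / i!` attached to a locally nilpotent derivation `D`. -/
noncomputable def expAut [CharZero k] (D : Derivation k A A) (hD : IsLocallyNilpotent D) : A ≃ₐ[k] A where
  toFun := expFun D
  invFun := expFun ((-1 : k) • D)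
  left_inv := expFun_neg_expFun D hD
  right_inv f := by
    have h := expFun_neg_expFun ((-1 : k) • D) (hD.smul _) f
    simpa [smul_smul] using h
  map_mul' := expFun_mul D hD
  map_add' := expFun_add D hD
  commutes' := expFun_algebraMap D

end Exponential

section Unipotent

variable {k : Type*} [Field k]

/-- `U ⊆ GL_m(k)` is a unipotent linear algebraic group: a Zariski closed subgroup of `GL_m(k)`
consisting of unipotent matrices. -/
def IsUnipotentLinearGroup {m : ℕ} (U : Subgroup (GL (Fin m) k)) : Prop :=
  (∃ I : Set (MvPolynomial (Fin m × Fin m) k), ∀ g : GL (Fin m) k,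
    g ∈ U ↔ ∀ p ∈ I, MvPolynomial.eval (fun ij => (g : Matrix (Fin m) (Fin m) k) ij.1 ij.2) p = 0) ∧
  ∀ g ∈ U, IsNilpotent ((g : Matrix (Fin m) (Fin m) k) - 1)

/-- The action on the algebra `A` of a linear algebraic group `U`, given by `φ`, is regular
(the action map `U × Spec A → Spec A` is a morphism): for every `f : A` the element `u · f` of `A`
is a finite sum `∑ l, P l (u) • a l` with `P l` a polynomial function on `U`.
(On a unipotent group `det = 1`, so all regular functions on `U` are polynomials in the matrix
entries.) -/
def IsRegularAction {A : Type*} [CommRing A] [Algebra k A] {m : ℕ} (U : Subgroup (GL (Fin m) k))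
    (φ : U →* (A ≃ₐ[k] A)) : Prop :=
  ∀ f : A, ∃ (q : ℕ) (P : Fin q → MvPolynomial (Fin m × Fin m) k) (a : Fin q → A), ∀ u : U,
    φ u f = ∑ l, MvPolynomial.eval
      (fun ij => ((u : GL (Fin m) k) : Matrix (Fin m) (Fin m) k) ij.1 ij.2) (P l) • a l

/-- The group `G` of automorphisms of the affine variety with coordinate algebra `A` is a unipotent
algebraic group: it is the isomorphic image of a unipotent linear algebraic group acting regularly
and effectively on the variety. -/
def IsUnipotentAlgebraicGroup {A : Type*} [CommRing A] [Algebra k A]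
    (G : Subgroup (A ≃ₐ[k] A)) : Prop :=
  ∃ (m : ℕ) (U : Subgroup (GL (Fin m) k)) (φ : U →* (A ≃ₐ[k] A)),
    IsUnipotentLinearGroup U ∧ IsRegularAction U φ ∧ Function.Injective φ ∧ φ.range = G

end Unipotent

section Generated

variable {k : Type*} [Field k] [CharZero k] {A : Type*} [CommRing A] [Algebra k A]

/-- The one-parameter subgroup `{exp (t D) | t ∈ k}`. -/
def oneParameterSubgroup (D : Derivation k A A) (hD : IsLocallyNilpotent D) : Set (A ≃ₐ[k] A) :=
  Set.range fun t : k => expAut (t • D) (hD.smul t)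

/-- The group `⟨exp (t D₁), exp (t D₂) | t ∈ k⟩`. -/
def groupGenerated (D₁ D₂ : Derivation k A A) (h₁ : IsLocallyNilpotent D₁)
    (h₂ : IsLocallyNilpotent D₂) : Subgroup (A ≃ₐ[k] A) :=
  Subgroup.closure (oneParameterSubgroup D₁ h₁ ∪ oneParameterSubgroup D₂ h₂)

end Generated

section LieGenerated

variable {k : Type*} [Field k] {A : Type*} [CommRing A] [Algebra k A]

/-- The Lie algebra over `k` generated by two derivations. -/
def lieGenerated (D₁ D₂ : Derivation k A A) : LieSubalgebra k (Derivation k A A) :=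
  LieSubalgebra.lieSpan k (Derivation k A A) {D₁, D₂}

end LieGenerated

section Toric

/-- `ρ` is the ray generator of an extremal ray of the cone `σ`: a primitive lattice vector spanning
a one-dimensional face. -/
def IsRayGenerator {n : ℕ} (σ : PointedCone ℚ (Fin n → ℚ)) (ρ : Fin n → ℤ) : Prop :=
  (PointedCone.hull ℚ {fun i => (ρ i : ℚ)}).IsFaceOf σ ∧ ∀ d : ℤ, (∀ i, d ∣ ρ i) → IsUnit d

/-- The combinatorial data of a normal affine toric variety with torus `𝔾_m ^ n` and without torus
factor: a strongly convex, full-dimensional polyhedral cone in `N_ℚ = ℚ ^ n`, together with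
an enumeration of its ray generators in `N = ℤ ^ n`. -/
structure ToricCone (n : ℕ) where
  /-- the cone `Δ_ℚ` -/
  cone : PointedCone ℚ (Fin n → ℚ)
  polyhedral : cone.FG
  salient : (cone : ConvexCone ℚ (Fin n → ℚ)).Salient
  full : Submodule.span ℚ (cone : Set (Fin n → ℚ)) = ⊤
  /-- the number of rays -/
  numRays : ℕ
  /-- the ray generators `ρ_j` -/
  ray : Fin numRays → Fin n → ℤ
  ray_injective : Function.Injective ray
  range_ray : Set.range ray = {ρ | IsRayGenerator cone ρ}

open Matrix in
theorem nonneg_of_nonneg_on_rays {n : ℕ} {σ : PointedCone ℚ (Fin n → ℚ)} (hfg : σ.FG)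
    (hs : (σ : ConvexCone ℚ (Fin n → ℚ)).Salient) (m : Fin n → ℚ)
    (hm : ∀ ρ, IsRayGenerator σ ρ → 0 ≤ (fun i => (ρ i : ℚ)) ⬝ᵥ m) :
    ∀ v ∈ σ, 0 ≤ v ⬝ᵥ m := by
  classical
  have hsal : ∀ x ∈ σ, -x ∈ σ → x = 0 := fun x hx hx' => by
    by_contra h
    exact hs x hx h hx'
  -- a generating set of minimal cardinality
  have hex : ∃ c, ∃ S : Finset (Fin n → ℚ), PointedCone.hull ℚ (S : Set (Fin n → ℚ)) = σ ∧
      S.card = c := by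
    obtain ⟨S, hS⟩ := hfg
    exact ⟨_, S, hS, rfl⟩
  obtain ⟨S, hS, hcard⟩ := Nat.find_spec hex
  have hmin : ∀ s ∈ S, PointedCone.hull ℚ ((S.erase s : Finset _) : Set (Fin n → ℚ)) ≠ σ := by
    intro s hsS heq
    have h1 := Nat.find_min' hex ⟨S.erase s, heq, rfl⟩
    have h2 := Finset.card_erase_lt_of_mem hsS
    omega
  have hsub : ∀ s ∈ S, s ∈ σ := fun s hsS => by
    rw [← hS]; exact Submodule.subset_span hsS
  have hgen : ∀ s ∈ S, 0 ≤ s ⬝ᵥ m := by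
    intro s hsS
    have hins : insert s ((S.erase s : Finset _) : Set (Fin n → ℚ)) = S := by
      rw [← Finset.coe_insert, Finset.insert_erase hsS]
    have hle : PointedCone.hull ℚ ((S.erase s : Finset _) : Set (Fin n → ℚ)) ≤ σ := by
      rw [← hS]
      exact Submodule.span_mono (by simp)
    have hnot : s ∉ PointedCone.hull ℚ ((S.erase s : Finset _) : Set (Fin n → ℚ)) := by
      intro h
      apply hmin s hsS
      apply le_antisymm hle
      conv_lhs => rw [← hS]
      refine Submodule.span_le.mpr fun x hx => ?_
      by_cases hxs : x = s
      · rw [hxs]; exact h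
      · exact Submodule.subset_span (by simp [hxs]; exact hx)
    have hdec : ∀ x ∈ σ, ∃ (α : ℚ) (x' : Fin n → ℚ), 0 ≤ α ∧
        x' ∈ PointedCone.hull ℚ ((S.erase s : Finset _) : Set (Fin n → ℚ)) ∧ x = α • s + x' := by
      intro x hx
      rw [← hS, ← hins] at hx
      obtain ⟨α, x', hx', rfl⟩ := Submodule.mem_span_insert.mp hx
      exact ⟨α, x', α.2, hx', rfl⟩
    have hface : (PointedCone.hull ℚ {s}).IsFaceOf σ := by
      refine ⟨Submodule.span_le.mpr (by simpa using hsub s hsS), ?_⟩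
      intro x y a hx hy ha hxy
      obtain ⟨α, x', hα, hx', rfl⟩ := hdec x hx
      obtain ⟨β, y', hβ, hy', rfl⟩ := hdec y hy
      obtain ⟨r, hr⟩ := Submodule.mem_span_singleton.mp hxy
      have hr' : (r : ℚ) • s = a • (α • s + x') + (β • s + y') := hr
      have hsum : a • x' + y' ∈ PointedCone.hull ℚ ((S.erase s : Finset _) : Set (Fin n → ℚ)) :=
        add_mem (PointedCone.smul_mem _ ha.le hx') hy'
      have heq : a • x' + y' = ((r : ℚ) - a * α - β) • s := by
        have : a • x' + y' = (r : ℚ) • s - (a * α) • s - β • s := by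
          rw [hr']; module
        rw [this]; module
      have hx0 : x' = 0 := by
        rcases le_or_gt ((r : ℚ) - a * α - β) 0 with hc | hc
        · have hneg : -(a • x') ∈ σ := by
            have : -(a • x') = y' + (-((r : ℚ) - a * α - β)) • s := by
              rw [neg_smul, ← heq]; abel
            rw [this]
            exact add_mem (hle hy') (PointedCone.smul_mem _ (by linarith) (hsub s hsS))
          have := hsal _ (PointedCone.smul_mem _ ha.le (hle hx')) hneg
          exact (smul_eq_zero.mp this).resolve_left ha.ne'
        · exfalso
          apply hnot
          have := PointedCone.smul_mem _ (inv_nonneg.mpr hc.le) hsum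
          rwa [heq, smul_smul, inv_mul_cancel₀ hc.ne', one_smul] at this
      rw [hx0, add_zero]
      exact PointedCone.smul_mem _ hα (Submodule.subset_span rfl)
    have hs0 : s ≠ 0 := fun h => hnot (h ▸ zero_mem _)
    -- a primitive lattice vector on the ray of `s`
    obtain ⟨ρ, c, hc, hρ, hprim⟩ : ∃ (ρ : Fin n → ℤ) (c : ℚ), 0 < c ∧
        (s = c • fun i => (ρ i : ℚ)) ∧ ∀ d : ℤ, (∀ i, d ∣ ρ i) → IsUnit d := by
      obtain ⟨b, hb⟩ := IsLocalization.exist_integer_multiples_of_finite (nonZeroDivisors ℤ) s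
      choose w hw using hb
      have hb0 : (b : ℤ) ≠ 0 := nonZeroDivisors.ne_zero b.2
      obtain ⟨i₀, hi₀⟩ := Function.ne_iff.mp hs0
      have hw' : ∀ i, (w i : ℚ) = (b : ℤ) * s i := fun i => by
        have := hw i
        simpa [zsmul_eq_mul] using this
      have hbQ : ((b : ℤ) : ℚ) ≠ 0 := by exact_mod_cast hb0
      have hw0 : w i₀ ≠ 0 := by
        intro h
        have := hw' i₀
        rw [h, Int.cast_zero] at this
        exact (mul_ne_zero hbQ hi₀) this.symm
      have hg0 : Finset.univ.gcd w ≠ 0 := fun h =>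
        hw0 (Finset.gcd_eq_zero_iff.mp h i₀ (Finset.mem_univ _))
      obtain ⟨v, hv, hv1⟩ := Finset.extract_gcd w ⟨i₀, Finset.mem_univ i₀⟩
      set g := Finset.univ.gcd w with hg
      have hgQ : (g : ℚ) ≠ 0 := by exact_mod_cast hg0
      have hsv : ∀ i, s i = (g / (b : ℤ) : ℚ) * v i := by
        intro i
        have h1 := hw' i
        rw [hv i (Finset.mem_univ i)] at h1
        push_cast at h1
        field_simp
        linarith
      have hpv : ∀ d : ℤ, (∀ i, d ∣ v i) → IsUnit d := fun d hd =>
        isUnit_of_dvd_one (hv1 ▸ Finset.dvd_gcd fun i _ => hd i)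
      rcases lt_or_gt_of_ne (div_ne_zero hgQ hbQ) with h | h
      · refine ⟨fun i => -v i, -(g / (b : ℤ) : ℚ), by linarith, ?_, fun d hd =>
          hpv d fun i => (dvd_neg).mp (hd i)⟩
        funext i
        simp [hsv i]
      · refine ⟨v, _, h, ?_, hpv⟩
        funext i
        simp [hsv i]
    have hspan : PointedCone.hull ℚ {fun i => (ρ i : ℚ)} = PointedCone.hull ℚ {s} := by
      apply le_antisymm
      · refine Submodule.span_le.mpr ?_
        rw [Set.singleton_subset_iff]
        have := PointedCone.smul_mem (PointedCone.hull ℚ {s}) (inv_nonneg.mpr hc.le)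
          (Submodule.subset_span (Set.mem_singleton s))
        rwa [hρ, smul_smul, inv_mul_cancel₀ hc.ne', one_smul, ← hρ] at this
      · refine Submodule.span_le.mpr ?_
        rw [Set.singleton_subset_iff, hρ]
        exact PointedCone.smul_mem _ hc.le (Submodule.subset_span rfl)
    have h1 := hm ρ ⟨hspan ▸ hface, hprim⟩
    rw [hρ, smul_dotProduct, smul_eq_mul]
    exact mul_nonneg hc.le h1
  intro v hv
  rw [← hS] at hv
  induction hv using Submodule.span_induction with
  | mem x hx => exact hgen x hx
  | zero => simp
  | add x y _ _ hx hy => rw [add_dotProduct]; exact add_nonneg hx hy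
  | smul a x _ hx =>
    have : (a • x) ⬝ᵥ m = (a : ℚ) * (x ⬝ᵥ m) := smul_dotProduct (a : ℚ) x m
    rw [this]
    exact mul_nonneg a.2 hx

namespace ToricCone

open Matrix

variable {n : ℕ} (X : ToricCone n)

/-- The monoid `Δ^∨` of lattice points of the dual cone. -/
def dualMonoid : AddSubmonoid (Fin n → ℤ) where
  carrier := {m | ∀ v ∈ X.cone, 0 ≤ v ⬝ᵥ fun i => (m i : ℚ)}
  zero_mem' v _ := by
    have : (fun i => (((0 : Fin n → ℤ) i : ℤ) : ℚ)) = 0 := by ext; simp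
    rw [this, dotProduct_zero]
  add_mem' {a b} ha hb v hv := by
    have : (fun i => (((a + b) i : ℤ) : ℚ)) = (fun i => (a i : ℚ)) + fun i => (b i : ℚ) := by
      ext; simp
    rw [this, dotProduct_add]
    exact add_nonneg (ha v hv) (hb v hv)

theorem cast_dotProduct (v m : Fin n → ℤ) :
    ((fun i => (v i : ℚ)) ⬝ᵥ fun i => (m i : ℚ)) = ((v ⬝ᵥ m : ℤ) : ℚ) := by
  simp [dotProduct]

theorem isRayGenerator_ray (j : Fin X.numRays) : IsRayGenerator X.cone (X.ray j) := by
  have : X.ray j ∈ Set.range X.ray := ⟨j, rfl⟩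
  rwa [X.range_ray] at this

theorem mem_dualMonoid_iff (m : Fin n → ℤ) :
    m ∈ X.dualMonoid ↔ ∀ j, 0 ≤ X.ray j ⬝ᵥ m := by
  constructor
  · intro h j
    have h1 := h _ ((X.isRayGenerator_ray j).1.le (Submodule.subset_span rfl))
    rw [cast_dotProduct] at h1
    exact_mod_cast h1
  · intro h
    refine nonneg_of_nonneg_on_rays X.polyhedral X.salient _ fun ρ hρ => ?_
    have : ρ ∈ {ρ | IsRayGenerator X.cone ρ} := hρ
    rw [← X.range_ray] at this
    obtain ⟨j, rfl⟩ := this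
    rw [cast_dotProduct]
    exact_mod_cast h j

/-- The coordinate algebra `𝒪(X) = ⨁_{m ∈ Δ^∨} k χ^m`. -/
abbrev CoordRing (k : Type*) [Field k] : Type _ := AddMonoidAlgebra k X.dualMonoid

/-- `e` is a Demazure root belonging to the `j`-th Demazure facet `S_j`. -/
def IsDemazureRoot (j : Fin X.numRays) (e : Fin n → ℤ) : Prop :=
  X.ray j ⬝ᵥ e = -1 ∧ ∀ i, i ≠ j → 0 ≤ X.ray i ⬝ᵥ e

theorem add_mem_dualMonoid {j : Fin X.numRays} {e : Fin n → ℤ} (he : X.IsDemazureRoot j e)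
    {m : Fin n → ℤ} (hm : m ∈ X.dualMonoid) (h : X.ray j ⬝ᵥ m ≠ 0) : m + e ∈ X.dualMonoid := by
  rw [mem_dualMonoid_iff] at hm ⊢
  intro i
  rw [dotProduct_add]
  by_cases hij : i = j
  · subst hij
    have h1 := hm i
    have h2 := he.1
    omega
  · have h1 := hm i
    have h2 := he.2 i hij
    omega

variable (k : Type*) [Field k]

open Classical in
/-- The element `⟨ρ_j, m⟩ χ^{m+e}` of `𝒪(X)`; when `m + e ∉ Δ^∨`, the coefficient `⟨ρ_j, m⟩`
vanishes for a Demazure root `e ∈ S_j`, and the value is `0`. -/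
noncomputable def rootValue (j : Fin X.numRays) (e : Fin n → ℤ) (m : X.dualMonoid) :
    X.CoordRing k :=
  if h : (m : Fin n → ℤ) + e ∈ X.dualMonoid then
    AddMonoidAlgebra.single ⟨m + e, h⟩ ((X.ray j ⬝ᵥ (m : Fin n → ℤ) : ℤ) : k)
  else 0

/-- The linear map `χ^m ↦ ⟨ρ_j, m⟩ χ^{m+e}`. -/
noncomputable def rootLinearMap (j : Fin X.numRays) (e : Fin n → ℤ) :
    X.CoordRing k →ₗ[k] X.CoordRing k :=
  (Finsupp.linearCombination k (X.rootValue k j e)) ∘ₗ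
    (AddMonoidAlgebra.coeffLinearEquiv k).toLinearMap

theorem rootLinearMap_single (j : Fin X.numRays) (e : Fin n → ℤ) (m : X.dualMonoid) (c : k) :
    X.rootLinearMap k j e (AddMonoidAlgebra.single m c) = c • X.rootValue k j e m := by
  simp [rootLinearMap]

theorem rootValue_add {j : Fin X.numRays} {e : Fin n → ℤ} (he : X.IsDemazureRoot j e)
    (a b : X.dualMonoid) :
    X.rootValue k j e (a + b) = AddMonoidAlgebra.single a 1 * X.rootValue k j e b +
      AddMonoidAlgebra.single b 1 * X.rootValue k j e a := by
  have hone : ∀ a b : X.dualMonoid, (h : ((a + b : X.dualMonoid) : Fin n → ℤ) + e ∈ X.dualMonoid) →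
      AddMonoidAlgebra.single a (1 : k) * X.rootValue k j e b =
        AddMonoidAlgebra.single ⟨_, h⟩ ((X.ray j ⬝ᵥ (b : Fin n → ℤ) : ℤ) : k) := by
    intro a b h
    unfold rootValue
    split_ifs with hb
    · rw [AddMonoidAlgebra.single_mul_single, one_mul]
      congr 1
      ext1
      simp [add_assoc]
    · have : X.ray j ⬝ᵥ (b : Fin n → ℤ) = 0 := by
        by_contra hne
        exact hb (X.add_mem_dualMonoid he b.2 hne)
      simp [this]
  by_cases h : ((a + b : X.dualMonoid) : Fin n → ℤ) + e ∈ X.dualMonoid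
  · have h' : ((b + a : X.dualMonoid) : Fin n → ℤ) + e ∈ X.dualMonoid := by rwa [add_comm b a]
    rw [hone a b h, hone b a h', rootValue, dif_pos h]
    have : (⟨_, h'⟩ : X.dualMonoid) = ⟨_, h⟩ := by
      ext1; simp [add_comm]
    rw [this, ← AddMonoidAlgebra.single_add, ← Int.cast_add, ← dotProduct_add, add_comm (b : Fin n → ℤ)]
    rfl
  · have hz : X.ray j ⬝ᵥ ((a + b : X.dualMonoid) : Fin n → ℤ) = 0 := by
      by_contra hne
      exact h (X.add_mem_dualMonoid he (a + b).2 hne)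
    have ha := (X.mem_dualMonoid_iff _).mp a.2 j
    have hb := (X.mem_dualMonoid_iff _).mp b.2 j
    have hsum : X.ray j ⬝ᵥ (a : Fin n → ℤ) + X.ray j ⬝ᵥ (b : Fin n → ℤ) = 0 := by
      rw [← dotProduct_add]; exact hz
    have ha0 : X.ray j ⬝ᵥ (a : Fin n → ℤ) = 0 := by omega
    have hb0 : X.ray j ⬝ᵥ (b : Fin n → ℤ) = 0 := by omega
    simp [rootValue, ha0, hb0]

/-- The root derivation `∂_{ρ_j, e}` of `𝒪(X)`, given by `χ^m ↦ ⟨ρ_j, m⟩ χ^{m+e}`. -/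
noncomputable def rootDerivation {j : Fin X.numRays} {e : Fin n → ℤ} (he : X.IsDemazureRoot j e) :
    Derivation k (X.CoordRing k) (X.CoordRing k) :=
  Derivation.mk' (X.rootLinearMap k j e) (by
    intro f g
    induction f using AddMonoidAlgebra.induction_linear with
    | zero => simp
    | add f₁ f₂ h₁ h₂ => rw [add_mul, map_add, map_add, h₁, h₂]; simp only [smul_eq_mul]; ring
    | single a c =>
      induction g using AddMonoidAlgebra.induction_linear with
      | zero => simp
      | add g₁ g₂ h₁ h₂ => rw [mul_add, map_add, map_add, h₁, h₂]; simp only [smul_eq_mul]; ring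
      | single b d =>
        have hc : ∀ (a : X.dualMonoid) (c : k), (AddMonoidAlgebra.single a c : X.CoordRing k) =
            c • AddMonoidAlgebra.single a 1 := fun a c => by simp
        rw [AddMonoidAlgebra.single_mul_single, rootLinearMap_single, rootLinearMap_single,
          rootLinearMap_single, X.rootValue_add k he, hc a c, hc b d]
        simp only [smul_eq_mul, smul_mul_assoc, mul_smul_comm, smul_smul, smul_add]
        rw [mul_comm d c])

theorem rootDerivation_single {j : Fin X.numRays} {e : Fin n → ℤ} (he : X.IsDemazureRoot j e)
    (m : X.dualMonoid) (c : k) :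
    X.rootDerivation k he (AddMonoidAlgebra.single m c) = c • X.rootValue k j e m :=
  X.rootLinearMap_single k j e m c

theorem isLocallyNilpotent_rootDerivation {j : Fin X.numRays} {e : Fin n → ℤ}
    (he : X.IsDemazureRoot j e) : IsLocallyNilpotent (X.rootDerivation k he) := by
  have key : ∀ (N : ℕ) (m : X.dualMonoid) (c : k), X.ray j ⬝ᵥ (m : Fin n → ℤ) < N →
      (X.rootDerivation k he)^[N] (AddMonoidAlgebra.single m c) = 0 := by
    intro N
    induction N with
    | zero =>
      intro m c h
      have := (X.mem_dualMonoid_iff _).mp m.2 j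
      exact absurd h (by simpa using this)
    | succ N ih =>
      intro m c h
      rw [Function.iterate_succ_apply, rootDerivation_single, rootValue]
      split_ifs with hm
      · rw [AddMonoidAlgebra.smul_single]
        apply ih
        have := he.1
        simp only [dotProduct_add]
        push_cast at h
        omega
      · rw [smul_zero]; exact iterate_map_zero _ N
  intro f
  induction f using AddMonoidAlgebra.induction_linear with
  | zero => exact ⟨0, rfl⟩
  | add f g hf hg =>
    obtain ⟨a, ha⟩ := hf
    obtain ⟨b, hb⟩ := hg
    refine ⟨max a b, ?_⟩
    rw [iterate_map_add, iterate_zero_of_le _ ha (le_max_left a b),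
      iterate_zero_of_le _ hb (le_max_right a b), add_zero]
  | single m c =>
    refine ⟨(X.ray j ⬝ᵥ (m : Fin n → ℤ)).toNat + 1, key _ m c ?_⟩
    omega

/-- The lift `ê = (⟨ρ_i, e⟩)_i` of `e` to the Cox ring. -/
def coxRoot (e : Fin n → ℤ) : Fin X.numRays → ℤ := fun i => X.ray i ⬝ᵥ e

/-- The Cox ring `k[x_1, …, x_r]`, one variable for each ray. -/
abbrev CoxRing : Type _ := MvPolynomial (Fin X.numRays) k

/-- The lifted root derivation `∂̂ = M_j ∂/∂x_j` of the Cox ring, where `M_j = ∏_{i ≠ j} x_i ^ ê_i`;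
the exponents are nonnegative for a Demazure root `e ∈ S_j`. -/
noncomputable def coxDerivation (j : Fin X.numRays) (e : Fin n → ℤ) :
    Derivation k (X.CoxRing k) (X.CoxRing k) :=
  (∏ i ∈ Finset.univ.erase j, MvPolynomial.X i ^ (X.coxRoot e i).toNat : X.CoxRing k) •
    MvPolynomial.pderiv j

/-- For `i ≠ j`, `∂̂ = x_i ^ c N ∂/∂x_j` with `c = ⟨ρ_i, e⟩` and `N` a monomial in the variables
other than `x_i` and `x_j`. -/
theorem coxDerivation_eq {i j : Fin X.numRays} (hij : i ≠ j) (e : Fin n → ℤ) :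
    X.coxDerivation k j e =
      (MvPolynomial.X i ^ (X.ray i ⬝ᵥ e).toNat *
        ∏ l ∈ (Finset.univ.erase j).erase i, MvPolynomial.X l ^ (X.ray l ⬝ᵥ e).toNat :
          X.CoxRing k) • MvPolynomial.pderiv j := by
  rw [coxDerivation, ← Finset.mul_prod_erase (Finset.univ.erase j) _ (Finset.mem_erase.mpr
    ⟨hij, Finset.mem_univ i⟩)]
  rfl

theorem isLocallyNilpotent_coxDerivation (j : Fin X.numRays) (e : Fin n → ℤ) :
    IsLocallyNilpotent (X.coxDerivation k j e) := by
  have hi : ∀ i, i ≠ j → X.coxDerivation k j e (MvPolynomial.X i) = 0 := by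
    intro i hij
    rw [coxDerivation, Derivation.smul_apply, MvPolynomial.pderiv_X_of_ne hij, smul_zero]
  have hM : X.coxDerivation k j e
      (∏ i ∈ Finset.univ.erase j, MvPolynomial.X i ^ (X.coxRoot e i).toNat) = 0 := by
    refine Finset.prod_induction _ (fun f => X.coxDerivation k j e f = 0) ?_ (by simp) ?_
    · intro a b ha hb
      simp [Derivation.leibniz, ha, hb]
    · intro i hi'
      rw [Derivation.leibniz_pow, hi i (Finset.ne_of_mem_erase hi')]
      simp
  intro f
  induction f using MvPolynomial.induction_on with
  | C a => exact ⟨1, by simp [coxDerivation]⟩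
  | add f g hf hg =>
    obtain ⟨a, ha⟩ := hf
    obtain ⟨b, hb⟩ := hg
    refine ⟨max a b, ?_⟩
    rw [iterate_map_add, iterate_zero_of_le _ ha (le_max_left a b),
      iterate_zero_of_le _ hb (le_max_right a b), add_zero]
  | mul_X f i hf =>
    obtain ⟨a, ha⟩ := hf
    have hX : (X.coxDerivation k j e)^[2] (MvPolynomial.X i) = 0 := by
      by_cases hij : i = j
      · subst hij
        simp only [Function.iterate_succ, Function.iterate_zero, Function.comp, id]
        have : X.coxDerivation k i e (MvPolynomial.X i) =
            ∏ l ∈ Finset.univ.erase i, MvPolynomial.X l ^ (X.coxRoot e l).toNat := by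
          simp [coxDerivation]
        rw [this, hM]
      · simp [hi i hij]
    refine ⟨a + 2, ?_⟩
    rw [iterate_mul']
    refine Finset.sum_eq_zero fun p hp => ?_
    have hp' := Finset.HasAntidiagonal.mem_antidiagonal.mp hp
    rcases le_or_gt a p.1 with h | h
    · rw [iterate_zero_of_le _ ha h, zero_mul, smul_zero]
    · rw [iterate_zero_of_le _ hX (by omega : 2 ≤ p.2), mul_zero, smul_zero]

end ToricCone

end Toric

end RootSubgroups

/-! Write `c = ⟨ρ₂, e₁⟩` and `d = ⟨ρ₁, e₂⟩`. The toric triple and the Cox triple share one argument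
(`tfae_of_actsAsMonomial`): inside a Laurent polynomial ring all derivations involved have the form
`χ^m ↦ p(m) χ^{m+e}` with `p` additive, and the bracket of `(e, p)` and `(f, q)` is `(e + f, p(f) q
- q(e) p)`.

Necessity of `min = 0` rests on one obstruction. If `c` and `d` are positive, say `d ≤ c`, then no
power of `ad [∂₁, ∂₂]` kills `∂₁`: modulo the form of `[∂₁, ∂₂]`, each application multiplies the
coefficient of `ρ₁` by a positive integer (`ad_bracket_pow_ne_zero`). A nilpotent Lie algebra
forbids this. So does a unipotent group: in characteristic zero it is nilpotent as an abstract
group, so the iterated commutators of `exp(t∂₁)` with `[exp(t∂₁), exp(t∂₂)]` are eventually trivial,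
and their leading coefficients in `t` are exactly the brackets in question
(`exists_ad_bracket_pow_eq_zero`).

Conversely, let `d = 0`. The brackets `ad(∂₂)^i ∂₁` all carry multiples of `ρ₁`, commute with each
other, and vanish for `i > c`; so the Lie algebra is finite-dimensional and nilpotent. For the
group, pass to the Cox ring. There `Ĥ` consists precisely of the triangular maps `x₂ ↦ x₂ + tN₂`,
`x₁ ↦ x₁ + w` with `t ∈ k` and `w` in a finite-dimensional space of polynomials free of `x₁`. Hence
`Ĥ` is parametrized polynomially by an affine space, and
`isUnipotentAlgebraicGroup_of_parametrization` realizes it as a closed unipotent matrix group. The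
group `H` is the restriction of `Ĥ` to `𝒪(X)`, embedded by `χ^m ↦ ∏ x_i ^ ⟨ρ_i, m⟩`. Nothing is
lost, since an element of `Ĥ` that fixes a single monomial containing both `x₁` and `x₂` is trivial.
-/

namespace RootSubgroups

/-! ### Unipotent matrix groups are nilpotent -/

section UnipotentNilpotent

open scoped commutatorElement

/-- A group that embeds into `1 + J` for a nilpotent two-sided ideal `J` is nilpotent. -/
theorem isNilpotent_of_sub_one_mem {G R : Type*} [Group G] [Ring R] (J : Ideal R) [J.IsTwoSided]
    (hJ : IsNilpotent J) (f : G →* R) (hf : Function.Injective f) (h : ∀ g, f g - 1 ∈ J) :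
    Group.IsNilpotent G := by
  obtain ⟨N, hN⟩ := hJ
  -- The congruence subgroups modulo `J ^ n` descend from `G` at `n = 0` to the trivial group at `n
  -- = N`.
  let H : ℕ → Subgroup G := fun n =>
    { carrier := {g | f g - 1 ∈ J ^ n}
      one_mem' := by simp
      mul_mem' := fun {a b} ha hb => by
        have : f (a * b) - 1 = f a * (f b - 1) + (f a - 1) := by rw [map_mul]; noncomm_ring
        simp only [Set.mem_ofPred_eq] at ha hb ⊢
        rw [this]
        exact add_mem (Ideal.mul_mem_left _ _ hb) ha
      inv_mem' := fun {a} ha => by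
        have : f a⁻¹ - 1 = -(f a⁻¹ * (f a - 1)) := by
          rw [mul_sub, ← map_mul, inv_mul_cancel, map_one]; noncomm_ring
        simp only [Set.mem_ofPred_eq] at ha ⊢
        rw [this]
        exact neg_mem (Ideal.mul_mem_left _ _ ha) }
  rw [Subgroup.nilpotent_iff_finite_descending_central_series]
  refine ⟨N, H, ⟨?_, ?_⟩, ?_⟩
  · ext g
    simp [H, Submodule.pow_zero, Ideal.one_eq_top]
  · intro x n hx g
    change f ⁅x, g⁆ - 1 ∈ J ^ (n + 1)
    have hx' : f x - 1 ∈ J ^ n := hx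
    have : f ⁅x, g⁆ - 1 =
        ((f x - 1) * (f g - 1) - (f g - 1) * (f x - 1)) * (f x⁻¹ * f g⁻¹) := by
      have h1 : (f x - 1) * (f g - 1) - (f g - 1) * (f x - 1) = f (x * g) - f (g * x) := by
        rw [map_mul, map_mul]; noncomm_ring
      rw [h1, ← map_mul, sub_mul, ← map_mul, ← map_mul, commutatorElement_def]
      have h2 : g * x * (x⁻¹ * g⁻¹) = 1 := by group
      rw [h2, map_one, mul_assoc (x * g)]
    rw [this]
    refine Ideal.mul_mem_right _ _ (sub_mem ?_ ?_)
    · have := Ideal.mul_mem_mul hx' (h g)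
      rcases Nat.eq_zero_or_pos n with rfl | hn
      · rw [zero_add, Submodule.pow_one]
        exact Ideal.mul_mem_left _ _ (h g)
      · rwa [Submodule.pow_succ]
    · rw [Ideal.IsTwoSided.pow_succ]
      exact Ideal.mul_mem_mul (h g) hx'
  · rw [eq_bot_iff]
    intro g hg
    have hg' : f g - 1 ∈ J ^ N := hg
    rw [hN] at hg'
    have : f g = f 1 := by rw [map_one]; exact sub_eq_zero.mp hg'
    exact Subgroup.mem_bot.mpr (hf this)

/-- In characteristic zero an endomorphism all of whose positive powers have trace zero is
nilpotent. -/
theorem isNilpotent_of_trace_pow_eq_zero {k V : Type*} [Field k] [CharZero k] [AddCommGroup V]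
    [Module k V] [FiniteDimensional k V] (x : Module.End k V)
    (h : ∀ n : ℕ, LinearMap.trace k V (x ^ (n + 1)) = 0) : IsNilpotent x := by
  open Polynomial in
  obtain ⟨q, hq, hX⟩ := Polynomial.exists_eq_pow_rootMultiplicity_mul_and_not_dvd (minpoly k x)
    (minpoly.ne_zero (Algebra.IsIntegral.isIntegral x)) 0
  set a := (minpoly k x).rootMultiplicity 0
  rw [map_zero, sub_zero] at hq hX
  have hcop : IsCoprime (X ^ (a + 1)) q :=
    ((Polynomial.prime_X (R := k)).irreducible.coprime_iff_not_dvd.mpr hX).pow_left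
  obtain ⟨u, v, huv⟩ := hcop
  have hmin : x ^ a * aeval x q = 0 := by
    have := minpoly.aeval k x
    rw [hq] at this
    simpa using this
  -- Fitting projector onto the part where `x` is invertible. The exponent `a + 1` instead of `a`
  -- makes `e` a combination of positive powers of `x` even when `a = 0`, so its trace vanishes; an
  -- idempotent of trace zero is zero in characteristic zero.
  set e := aeval x (u * X ^ (a + 1)) with he
  have he1 : 1 - e = aeval x (v * q) := by
    have := congrArg (aeval x) huv
    rw [map_add, map_one] at this
    rw [← this]; abel
  have hidem : IsIdempotentElem e := by
    have : e * (1 - e) = 0 := by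
      rw [he1, he, ← map_mul]
      have h2 : u * X ^ (a + 1) * (v * q) = (u * X * v) * (X ^ a * q) := by ring
      rw [h2, map_mul, map_mul _ (X ^ a), map_pow, aeval_X, hmin, mul_zero]
    rw [mul_sub, mul_one, sub_eq_zero] at this
    exact this.symm
  have htr : LinearMap.trace k V e = 0 := by
    have : e = ∑ i ∈ u.support, u.coeff i • x ^ (i + a + 1) := by
      rw [he, map_mul, map_pow, aeval_X, aeval_eq_sum_range' (Nat.lt_succ_self _), Finset.sum_mul]
      rw [← Finset.sum_subset (Polynomial.supp_subset_range (Nat.lt_succ_self _))]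
      · refine Finset.sum_congr rfl fun i _ => ?_
        rw [smul_mul_assoc, ← pow_add, add_assoc]
      · intro i _ hi
        rw [Polynomial.notMem_support_iff.mp hi, zero_smul, zero_mul]
    rw [this, map_sum]
    refine Finset.sum_eq_zero fun i _ => ?_
    rw [map_smul, h, smul_zero]
  have he0 : e = 0 := LinearMap.IsIdempotentElem.eq_zero_of_trace_eq_zero hidem htr
  refine ⟨a, ?_⟩
  rw [he0, sub_zero] at he1
  calc x ^ a = x ^ a * 1 := (mul_one _).symm
    _ = 0 := by
      rw [he1, mul_comm v, map_mul, ← mul_assoc, hmin, zero_mul]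

/-- A group of unipotent matrices over a field of characteristic zero is nilpotent. -/
theorem isNilpotent_of_forall_isNilpotent_sub_one {k : Type*} [Field k] [CharZero k] {m : ℕ}
    (U : Subgroup (GL (Fin m) k))
    (hU : ∀ g ∈ U, IsNilpotent ((g : Matrix (Fin m) (Fin m) k) - 1)) : Group.IsNilpotent U := by
  let M := Matrix (Fin m) (Fin m) k
  let f₀ : U →* M := (Units.coeHom M).comp U.subtype
  let S : Subalgebra k M := Algebra.adjoin k (Set.range f₀)
  have hS : ∀ u, f₀ u ∈ S := fun u => Algebra.subset_adjoin ⟨u, rfl⟩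
  let f : U →* S := f₀.codRestrict S hS
  have hspan : Subalgebra.toSubmodule S = Submodule.span k (Set.range f₀) := by
    rw [Algebra.adjoin_eq_span]
    congr 1
    rw [← MonoidHom.coe_mrange, Submonoid.closure_eq]
  have htr1 : ∀ u, (f₀ u).trace = (m : k) := fun u => by
    have h1 := Matrix.isNilpotent_trace_of_isNilpotent (hU u u.2)
    have h2 := h1.eq_zero
    rw [Matrix.trace_sub, sub_eq_zero] at h2
    simpa [f₀] using h2
  -- All elements of `U` have trace `m` and `U` spans `S`, so `u - 1` is orthogonal to `S` for the
  -- trace form. Hence every `y (u - 1)` is nilpotent, which puts `u - 1` into the Jacobson radical,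
  -- a nilpotent ideal because `S` is Artinian.
  have htr : ∀ u : U, ∀ y ∈ S, (y * (f₀ u - 1)).trace = 0 := by
    intro u y hy
    have hy' : y ∈ Submodule.span k (Set.range f₀) := hspan ▸ hy
    induction hy' using Submodule.span_induction with
    | mem x hx =>
      obtain ⟨v, rfl⟩ := hx
      rw [mul_sub, mul_one, ← map_mul, Matrix.trace_sub, htr1, htr1, sub_self]
    | zero => simp
    | add a b ha hb h1 h2 =>
      rw [add_mul, Matrix.trace_add, h1 (by rw [← Subalgebra.mem_toSubmodule, hspan]; exact ha),
        h2 (by rw [← Subalgebra.mem_toSubmodule, hspan]; exact hb), add_zero]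
    | smul c a ha h1 =>
      rw [smul_mul_assoc, Matrix.trace_smul,
        h1 (by rw [← Subalgebra.mem_toSubmodule, hspan]; exact ha), smul_zero]
  have : IsArtinianRing S := isArtinian_of_tower k inferInstance
  let J : Ideal S := Ideal.jacobson ⊥
  have : J.IsTwoSided := inferInstance
  refine isNilpotent_of_sub_one_mem J IsArtinianRing.isNilpotent_jacobson_bot f ?_ ?_
  · intro a b hab
    have : f₀ a = f₀ b := congrArg Subtype.val hab
    exact Subtype.ext (Units.ext this)
  · intro u
    rw [Ideal.mem_jacobson_iff]
    intro y
    have hnil : IsNilpotent (y * (f u - 1)) := by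
      have h1 : IsNilpotent (Matrix.toLin' ((y * (f u - 1) : S) : M)) := by
        refine isNilpotent_of_trace_pow_eq_zero _ fun n => ?_
        rw [← Matrix.toLin'_pow, Matrix.trace_toLin'_eq]
        have : (((y * (f u - 1) : S) : M)) ^ (n + 1) =
            (((y * (f u - 1) : S) : M) ^ n * (y : M)) * (f₀ u - 1) := by
          rw [pow_succ, mul_assoc]; rfl
        rw [this]
        exact htr u _ (S.mul_mem (S.pow_mem (y * (f u - 1)).2 n) y.2)
      obtain ⟨N, hN⟩ := h1
      refine ⟨N, Subtype.ext ?_⟩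
      rw [← Matrix.toLin'_pow] at hN
      exact (Matrix.toLin' (R := k)).injective (hN.trans (map_zero _).symm)
    obtain ⟨z, hz⟩ := (hnil.isUnit_add_one).exists_left_inv
    refine ⟨z, ?_⟩
    rw [mul_add, mul_one, ← mul_assoc] at hz
    rw [Ideal.mem_bot, sub_eq_zero, hz]

end UnipotentNilpotent

/-! ### Expansions in `t`: from group commutators to Lie brackets -/

section FormalExpansion

open scoped commutatorElement

/-- Linear functionals reduce this to scalar polynomials over an infinite field. -/
theorem eq_zero_of_forall_sum_pow_smul_eq_zero {k V : Type*} [Field k] [Infinite k]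
    [AddCommGroup V] [Module k V] {N : ℕ} {v : ℕ → V}
    (h : ∀ t : k, ∑ n ∈ Finset.range N, t ^ n • v n = 0) {n : ℕ} (hn : n < N) : v n = 0 := by
  rw [← Module.forall_dual_apply_eq_zero_iff k]
  intro φ
  open Polynomial in
  have h0 : (∑ i ∈ Finset.range N, C (φ (v i)) * X ^ i : k[X]) = 0 := by
    refine Polynomial.funext fun t => ?_
    have := congrArg φ (h t)
    rw [map_zero, map_sum] at this
    rw [Polynomial.eval_zero, ← this, Polynomial.eval_finsetSum]
    refine Finset.sum_congr rfl fun i _ => ?_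
    rw [Polynomial.eval_mul, Polynomial.eval_C, Polynomial.eval_pow, Polynomial.eval_X, map_smul,
      smul_eq_mul, mul_comm]
  have h1 := congrArg (fun p : k[X] => p.coeff n) h0
  simp only [Polynomial.finsetSum_coeff, Polynomial.coeff_C_mul_X_pow, Polynomial.coeff_zero,
    Finset.sum_ite_eq, Finset.mem_range, hn, if_true] at h1
  exact h1

variable {k : Type*} [Field k] {A : Type*} [CommRing A] [Algebra k A]

/-- The formal power series `S` of operators is pointwise finite, and its value at `t` is `g t`. -/
def EvaluatesTo (S : PowerSeries (Module.End k A)) (g : k → (A ≃ₐ[k] A)) : Prop :=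
  ∀ f : A, ∃ N : ℕ, (∀ n, N ≤ n → PowerSeries.coeff n S f = 0) ∧
    ∀ t, g t f = ∑ n ∈ Finset.range N, t ^ n • PowerSeries.coeff n S f

theorem sum_range_eq_of_le {V : Type*} [AddCommMonoid V] {N M : ℕ} (hNM : N ≤ M) {v : ℕ → V}
    (hv : ∀ n, N ≤ n → v n = 0) : ∑ n ∈ Finset.range N, v n = ∑ n ∈ Finset.range M, v n := by
  refine Finset.sum_subset (by simpa using hNM) fun n _ hn => hv n ?_
  simpa using hn

/-- On a fixed `f` only finitely many coefficients of `T` act nontrivially, and `S` is finite on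
each of their values, so the Cauchy product is a finite double sum. -/
theorem EvaluatesTo.mul {S T : PowerSeries (Module.End k A)} {g h : k → (A ≃ₐ[k] A)}
    (hS : EvaluatesTo S g) (hT : EvaluatesTo T h) : EvaluatesTo (S * T) (g * h) := by
  intro f
  obtain ⟨N, hN, hNt⟩ := hT f
  choose M hM hMt using hS
  obtain ⟨K, hK⟩ : ∃ K, ∀ j < N, M (PowerSeries.coeff j T f) ≤ K :=
    ⟨∑ j ∈ Finset.range N, M (PowerSeries.coeff j T f), fun j hj =>
      Finset.single_le_sum (f := fun j => M (PowerSeries.coeff j T f)) (fun _ _ => Nat.zero_le _)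
        (Finset.mem_range.mpr hj)⟩
  have hz : ∀ i j, K ≤ i ∨ N ≤ j → PowerSeries.coeff i S (PowerSeries.coeff j T f) = 0 := by
    intro i j hij
    by_cases hj : N ≤ j
    · rw [hN j hj, map_zero]
    · exact hM _ _ ((hK j (not_le.mp hj)).trans (hij.resolve_right hj))
  have hcoeff : ∀ n, PowerSeries.coeff n (S * T) f =
      ∑ p ∈ Finset.HasAntidiagonal.antidiagonal n,
        PowerSeries.coeff p.1 S (PowerSeries.coeff p.2 T f) := by
    intro n
    rw [PowerSeries.coeff_mul, LinearMap.sum_apply]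
    rfl
  have hlarge : ∀ i j, K + N ≤ i + j → K ≤ i ∨ N ≤ j := fun i j h => by omega
  refine ⟨K + N, fun n hn => ?_, fun t => ?_⟩
  · rw [hcoeff]
    refine Finset.sum_eq_zero fun p hp => hz _ _ (hlarge _ _ ?_)
    rwa [Finset.HasAntidiagonal.mem_antidiagonal.mp hp]
  · have h1 : (g t * h t : A ≃ₐ[k] A) f = ∑ i ∈ Finset.range K, ∑ j ∈ Finset.range N,
        t ^ (i + j) • PowerSeries.coeff i S (PowerSeries.coeff j T f) := by
      rw [Finset.sum_comm, AlgEquiv.mul_apply, hNt, map_sum]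
      refine Finset.sum_congr rfl fun j hj => ?_
      rw [map_smul, hMt, sum_range_eq_of_le (hK j (Finset.mem_range.mp hj)), Finset.smul_sum]
      · refine Finset.sum_congr rfl fun i _ => ?_
        rw [smul_smul, ← pow_add, add_comm]
      · intro n hn
        rw [hM _ _ hn, smul_zero]
    rw [Pi.mul_apply, h1, sum_sum_eq_sum_antidiagonal _ (K + N)]
    · refine Finset.sum_congr rfl fun n _ => ?_
      rw [hcoeff, Finset.smul_sum]
      refine Finset.sum_congr rfl fun p hp => ?_
      rw [Finset.HasAntidiagonal.mem_antidiagonal.mp hp]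
    · intro i j hij
      rw [hz _ _ (hlarge _ _ hij), smul_zero]
    · intro i j hi
      rw [hz _ _ (Or.inl hi), smul_zero]
    · intro i j hj
      rw [hz _ _ (Or.inr hj), smul_zero]

/-- Uniqueness of expansions: on each `f` the values form a polynomial in `t`, whose coefficients
are determined because `k` is infinite. -/
theorem EvaluatesTo.eq_one [Infinite k] {S : PowerSeries (Module.End k A)} {g : k → (A ≃ₐ[k] A)}
    (hS : EvaluatesTo S g) (hg : g = 1) : S = 1 := by
  ext n f
  obtain ⟨N, hN, hNt⟩ := hS f
  have hone : ∀ n, PowerSeries.coeff n (1 : PowerSeries (Module.End k A)) f =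
      if n = 0 then f else 0 := by
    intro n
    rw [PowerSeries.coeff_one]
    split_ifs <;> rfl
  -- The range `N + 1` includes the constant term even when `N = 0`.
  have key : ∀ t : k, ∑ n ∈ Finset.range (N + 1), t ^ n •
      (PowerSeries.coeff n S f - PowerSeries.coeff n (1 : PowerSeries (Module.End k A)) f) = 0 := by
    intro t
    simp only [smul_sub, Finset.sum_sub_distrib, hone]
    rw [← sum_range_eq_of_le (Nat.le_succ N) (v := fun n => t ^ n • PowerSeries.coeff n S f),
      ← hNt, hg, Finset.sum_eq_single 0]
    · simp
    · intro n _ hn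
      simp [hn]
    · simp
    · intro n hn
      rw [hN n hn, smul_zero]
  rcases lt_or_ge n (N + 1) with h | h
  · exact sub_eq_zero.mp (eq_zero_of_forall_sum_pow_smul_eq_zero key h)
  · rw [hN n (by omega), hone, if_neg (by omega)]

/-- The family of automorphisms `g t` has an expansion `1 + t ^ n Y + …` in powers of `t`. -/
def HasExpansion (g : k → (A ≃ₐ[k] A)) (n : ℕ) (Y : Module.End k A) : Prop :=
  ∃ S : (PowerSeries (Module.End k A))ˣ, EvaluatesTo (S : PowerSeries (Module.End k A)) g ∧
    EvaluatesTo ((S⁻¹ : (PowerSeries (Module.End k A))ˣ) : PowerSeries (Module.End k A))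
      g⁻¹ ∧
    ∃ p : PowerSeries (Module.End k A),
      (S : PowerSeries (Module.End k A)) = 1 + PowerSeries.X ^ n * p ∧
        PowerSeries.constantCoeff p = Y

/-- With `S = 1 + X^a p` and `T = 1 + X^b q` one has `STS⁻¹T⁻¹ - 1 = (ST - TS) S⁻¹T⁻¹` and `ST - TS
= X^(a+b) (pq - qp)`, as `X` is central. Positivity of `a` and `b` makes the constant terms of `S⁻¹`
and `T⁻¹` equal to `1`, so the leading coefficient is the bracket. -/
theorem HasExpansion.commutator {g h : k → (A ≃ₐ[k] A)} {a b : ℕ} (ha : a ≠ 0) (hb : b ≠ 0)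
    {Y Z : Module.End k A} (hg : HasExpansion g a Y) (hh : HasExpansion h b Z) :
    HasExpansion (g * h * g⁻¹ * h⁻¹) (a + b) ⁅Y, Z⁆ := by
  obtain ⟨S, hS, hS', p, hp, rfl⟩ := hg
  obtain ⟨T, hT, hT', q, hq, rfl⟩ := hh
  have hX : ∀ (n : ℕ) (r : PowerSeries (Module.End k A)),
      r * PowerSeries.X ^ n = PowerSeries.X ^ n * r :=
    fun n r => ((PowerSeries.commute_X r).pow_right n).eq
  have hc : ∀ (V : (PowerSeries (Module.End k A))ˣ) (n : ℕ) (r : PowerSeries (Module.End k A)),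
      n ≠ 0 → (V : PowerSeries (Module.End k A)) = 1 + PowerSeries.X ^ n * r →
      PowerSeries.constantCoeff
        ((V⁻¹ : (PowerSeries (Module.End k A))ˣ) : PowerSeries (Module.End k A)) = 1 := by
    intro V n r hn hV
    have h1 := congrArg PowerSeries.constantCoeff V.mul_inv
    have h2 : PowerSeries.constantCoeff (V : PowerSeries (Module.End k A)) = 1 := by
      rw [hV]
      simp [hn]
    rw [map_mul, h2, one_mul] at h1
    simpa using h1
  refine ⟨⁅S, T⁆, ((hS.mul hT).mul hS').mul hT', ?_,
    (p * q - q * p) * (((S⁻¹ : (PowerSeries (Module.End k A))ˣ) : PowerSeries (Module.End k A)) *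
      ((T⁻¹ : (PowerSeries (Module.End k A))ˣ) : PowerSeries (Module.End k A))), ?_, ?_⟩
  · have : (g * h * g⁻¹ * h⁻¹)⁻¹ = h * g * h⁻¹ * g⁻¹ := by group
    rw [this, commutatorElement_inv]
    exact ((hT.mul hS).mul hT').mul hS'
  · have h1 : (S : PowerSeries (Module.End k A)) * (T : PowerSeries (Module.End k A)) -
        (T : PowerSeries (Module.End k A)) * (S : PowerSeries (Module.End k A)) =
        PowerSeries.X ^ (a + b) * (p * q - q * p) := by
      rw [hp, hq]
      have e1 : PowerSeries.X ^ a * p * (PowerSeries.X ^ b * q) =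
          PowerSeries.X ^ (a + b) * (p * q) := by
        rw [mul_assoc, ← mul_assoc p, hX b p, pow_add]; simp only [mul_assoc]
      have e2 : PowerSeries.X ^ b * q * (PowerSeries.X ^ a * p) =
          PowerSeries.X ^ (a + b) * (q * p) := by
        rw [mul_assoc, ← mul_assoc q, hX a q, add_comm, pow_add]; simp only [mul_assoc]
      rw [mul_sub, ← e1, ← e2]
      noncomm_ring
    rw [← mul_assoc, ← h1]
    have h2 : (T : PowerSeries (Module.End k A)) * (S : PowerSeries (Module.End k A)) *
        (((S⁻¹ : (PowerSeries (Module.End k A))ˣ) : PowerSeries (Module.End k A)) *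
          ((T⁻¹ : (PowerSeries (Module.End k A))ˣ) : PowerSeries (Module.End k A))) = 1 := by
      rw [← Units.val_mul, ← Units.val_mul, ← Units.val_mul]
      have : T * S * (S⁻¹ * T⁻¹) = 1 := by group
      rw [this, Units.val_one]
    rw [sub_mul, h2, commutatorElement_def]
    simp only [Units.val_mul, mul_assoc]
    abel
  · rw [map_mul, map_mul, hc S a p ha hp, hc T b q hb hq, map_sub, map_mul, map_mul, mul_one,
      mul_one]
    rfl

theorem HasExpansion.eq_zero [Infinite k] {g : k → (A ≃ₐ[k] A)} {n : ℕ} {Y : Module.End k A}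
    (hg : HasExpansion g n Y) (h : g = 1) : Y = 0 := by
  obtain ⟨S, hS, -, p, hp, rfl⟩ := hg
  have h1 : (S : PowerSeries (Module.End k A)) = 1 := hS.eq_one h
  rw [h1, left_eq_add] at hp
  have h2 := congrArg (PowerSeries.coeff n) hp
  rw [PowerSeries.coeff_X_pow_mul', if_pos le_rfl, Nat.sub_self] at h2
  simpa using h2

variable [CharZero k]

theorem evaluatesTo_expAut (D : Derivation k A A) (hD : IsLocallyNilpotent D) :
    EvaluatesTo
      (PowerSeries.mk fun n => ((n.factorial : k)⁻¹) • (D : Module.End k A) ^ n)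
      fun t => expAut (t • D) (hD.smul t) := by
  intro f
  obtain ⟨N, hN⟩ := hD f
  have hpow : ∀ n, ((D : Module.End k A) ^ n) f = D^[n] f := fun n => by
    rw [Module.End.pow_apply]; rfl
  refine ⟨N, fun n hn => ?_, fun t => ?_⟩
  · rw [PowerSeries.coeff_mk, LinearMap.smul_apply, hpow, iterate_zero_of_le D hN hn, smul_zero]
  · have h0 : (t • D)^[N] f = 0 := by rw [smul_iterate, hN, smul_zero]
    change expFun (t • D) f = _
    rw [expFun_eq_sum _ h0]
    refine Finset.sum_congr rfl fun n _ => ?_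
    rw [PowerSeries.coeff_mk, LinearMap.smul_apply, hpow, smul_iterate, smul_comm]

theorem expAut_neg_smul (D : Derivation k A A) (hD : IsLocallyNilpotent D) (t : k) :
    expAut (t • (-D)) ((neg_one_smul k D ▸ hD.smul (-1) : IsLocallyNilpotent (-D)).smul t) =
      (expAut (t • D) (hD.smul t))⁻¹ := by
  ext f
  change expFun (t • (-D)) f = expFun ((-1 : k) • t • D) f
  rw [neg_one_smul, smul_neg]

theorem hasExpansion_expAut (D : Derivation k A A) (hD : IsLocallyNilpotent D) :
    HasExpansion (fun t => expAut (t • D) (hD.smul t)) 1 (D : Module.End k A) := by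
  have hD' : IsLocallyNilpotent (-D) := neg_one_smul k D ▸ hD.smul (-1)
  have h1 := evaluatesTo_expAut D hD
  have h2 := evaluatesTo_expAut (-D) hD'
  have h3 : EvaluatesTo
      (PowerSeries.mk fun n => ((n.factorial : k)⁻¹) • ((-D : Derivation k A A) : Module.End k A) ^ n)
      (fun t => expAut (t • D) (hD.smul t))⁻¹ := by
    have : (fun t => expAut (t • D) (hD.smul t))⁻¹ = fun t => expAut (t • (-D)) (hD'.smul t) :=
      funext fun t => (expAut_neg_smul D hD t).symm
    rw [this]
    exact h2
  -- The exponential series of `D` and `-D` are inverse by uniqueness of expansions, since their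
  -- values are inverse automorphisms; no series identity has to be computed.
  let S : (PowerSeries (Module.End k A))ˣ :=
    { val := _
      inv := _
      val_inv := (h1.mul h3).eq_one (mul_inv_cancel _)
      inv_val := (h3.mul h1).eq_one (inv_mul_cancel _) }
  refine ⟨S, h1, h3, PowerSeries.mk fun n =>
    (((n + 1).factorial : k)⁻¹) • (D : Module.End k A) ^ (n + 1), ?_, ?_⟩
  · ext n : 1
    rw [pow_one, map_add]
    cases n with
    | zero => simp [S]
    | succ n => simp [S, PowerSeries.coeff_one, PowerSeries.coeff_succ_X_mul]
  · simp [← PowerSeries.coeff_zero_eq_constantCoeff_apply]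

/-- If the group generated by two one-parameter subgroups is nilpotent, then the bracket of the
two derivations is ad-nilpotent on the first. -/
theorem exists_ad_bracket_pow_eq_zero (D₁ D₂ : Derivation k A A) (h₁ : IsLocallyNilpotent D₁)
    (h₂ : IsLocallyNilpotent D₂) (hnil : Group.IsNilpotent (groupGenerated D₁ D₂ h₁ h₂)) :
    ∃ N : ℕ, ((LieAlgebra.ad k (Derivation k A A) ⁅D₁, D₂⁆) ^ N) D₁ = 0 := by
  set G := groupGenerated D₁ D₂ h₁ h₂
  let g₁ : k → (A ≃ₐ[k] A) := fun t => expAut (t • D₁) (h₁.smul t)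
  let g₂ : k → (A ≃ₐ[k] A) := fun t => expAut (t • D₂) (h₂.smul t)
  have hg₁ : ∀ t, g₁ t ∈ G := fun t => Subgroup.subset_closure (Or.inl ⟨t, rfl⟩)
  have hg₂ : ∀ t, g₂ t ∈ G := fun t => Subgroup.subset_closure (Or.inr ⟨t, rfl⟩)
  have hg : ∀ t, ⁅g₁ t, g₂ t⁆ ∈ G := fun t =>
    Subgroup.commutator_le_self G (Subgroup.commutator_mem_commutator (hg₁ t) (hg₂ t))
  have hexp : HasExpansion (g₁ * g₂ * g₁⁻¹ * g₂⁻¹) 2 (⁅D₁, D₂⁆ : Derivation k A A) := by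
    have := (hasExpansion_expAut D₁ h₁).commutator one_ne_zero one_ne_zero
      (hasExpansion_expAut D₂ h₂)
    rwa [← Derivation.commutator_coe_linear_map] at this
  -- Start from `g₁` and repeatedly take the commutator with `⁅g₁, g₂⁆`. Each step goes down the
  -- lower central series by one and applies `ad ⁅D₁, D₂⁆` to the leading coefficient.
  have key : ∀ i : ℕ, ∃ c : k → (A ≃ₐ[k] A), (∀ t, c t ∈ G.lowerCentralSeries i) ∧
      ∃ n ≠ 0, HasExpansion c n
        (((LieAlgebra.ad k (Derivation k A A) ⁅D₁, D₂⁆) ^ i) D₁ : Derivation k A A) := by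
    intro i
    induction i with
    | zero => exact ⟨g₁, hg₁, 1, one_ne_zero, hasExpansion_expAut D₁ h₁⟩
    | succ i ih =>
      obtain ⟨c, hc, n, hn, hcn⟩ := ih
      refine ⟨fun t => ⁅⁅g₁ t, g₂ t⁆, c t⁆, fun t => ?_, 2 + n, by omega, ?_⟩
      · rw [Subgroup.lowerCentralSeries_succ, Subgroup.commutator_comm]
        exact Subgroup.commutator_mem_commutator (hg t) (hc t)
      · have := hexp.commutator two_ne_zero hn hcn
        rw [← Derivation.commutator_coe_linear_map] at this
        rw [pow_succ', Module.End.mul_apply, LieAlgebra.ad_apply]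
        exact this
  obtain ⟨N, hN⟩ := (Subgroup.isNilpotent_iff_lowerCentralSeries G).mp hnil
  obtain ⟨c, hc, n, -, hcn⟩ := key N
  refine ⟨N, ?_⟩
  have h0 := hcn.eq_zero (funext fun t => Subgroup.mem_bot.mp (hN ▸ hc t))
  ext f
  exact LinearMap.congr_fun h0 f

end FormalExpansion

/-! ### A nilpotency criterion for two-generator Lie algebras -/

section LieSpanPair

variable {k L : Type*} [Field k] [LieRing L] [LieAlgebra k L]

/-- If the iterated brackets `ad(x)^i y` commute with each other and eventually vanish, then `x`
and `y` generate a finite-dimensional nilpotent Lie algebra. -/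
theorem finiteDimensional_and_isNilpotent_lieSpan_pair (x y : L)
    (hcomm : ∀ i j : ℕ, ⁅((LieAlgebra.ad k L x) ^ i) y, ((LieAlgebra.ad k L x) ^ j) y⁆ = 0)
    {N : ℕ} (hN : ((LieAlgebra.ad k L x) ^ N) y = 0) :
    FiniteDimensional k (LieSubalgebra.lieSpan k L {x, y}) ∧
      LieRing.IsNilpotent (LieSubalgebra.lieSpan k L {x, y}) := by
  set z : ℕ → L := fun i => ((LieAlgebra.ad k L x) ^ i) y with hz
  have hsucc : ∀ i, ⁅x, z i⁆ = z (i + 1) := fun i => by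
    simp only [hz]
    rw [pow_succ', Module.End.mul_apply, LieAlgebra.ad_apply]
  have hz0 : ∀ i, N ≤ i → z i = 0 := fun i hi => by
    obtain ⟨j, rfl⟩ := Nat.exists_eq_add_of_le' hi
    simp only [hz]
    rw [pow_add, Module.End.mul_apply, hN, map_zero]
  -- A descending filtration of an abelian ideal: `ad x` maps `F j` into `F (j + 1)`, and `F N = 0`.
  let F : ℕ → Submodule k L := fun j => Submodule.span k (z '' Set.Ici j)
  have hF : ∀ i j, j ≤ i → z i ∈ F j := fun i j h => Submodule.subset_span ⟨i, h, rfl⟩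
  have hFN : F N = ⊥ := by
    rw [eq_bot_iff]
    refine Submodule.span_le.mpr ?_
    rintro _ ⟨i, hi, rfl⟩
    exact hz0 i hi
  have hcommF : ∀ u ∈ F 0, ∀ v ∈ F 0, ⁅u, v⁆ = 0 := by
    intro u hu v hv
    induction hu using Submodule.span_induction with
    | mem u hu =>
      obtain ⟨i, -, rfl⟩ := hu
      induction hv using Submodule.span_induction with
      | mem v hv => obtain ⟨j, -, rfl⟩ := hv; exact hcomm i j
      | zero => exact lie_zero _
      | add v w _ _ h1 h2 => rw [lie_add, h1, h2, add_zero]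
      | smul c v _ h1 => rw [lie_smul, h1, smul_zero]
    | zero => exact zero_lie _
    | add u w _ _ h1 h2 => rw [add_lie, h1, h2, add_zero]
    | smul c u _ h1 => rw [smul_lie, h1, smul_zero]
  have hF0 : ∀ j, F j ≤ F 0 := fun j => Submodule.span_mono (Set.image_mono fun i _ => Nat.zero_le i)
  have hxF : ∀ j, ∀ v ∈ F j, ⁅x, v⁆ ∈ F (j + 1) := by
    intro j v hv
    induction hv using Submodule.span_induction with
    | mem v hv =>
      obtain ⟨i, hi, rfl⟩ := hv
      rw [hsucc]
      exact hF _ _ (Nat.succ_le_succ hi)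
    | zero => rw [lie_zero]; exact zero_mem _
    | add v w _ _ h1 h2 => rw [lie_add]; exact add_mem h1 h2
    | smul c v _ h1 => rw [lie_smul]; exact Submodule.smul_mem _ _ h1
  let M : Submodule k L := Submodule.span k {x} ⊔ F 0
  have hM : ∀ u ∈ M, ∃ (a : k), ∃ v ∈ F 0, u = a • x + v := by
    intro u hu
    obtain ⟨w, hw, v, hv, rfl⟩ := Submodule.mem_sup.mp hu
    obtain ⟨a, rfl⟩ := Submodule.mem_span_singleton.mp hw
    exact ⟨a, v, hv, rfl⟩
  have hMF : ∀ u ∈ M, ∀ j, ∀ v ∈ F j, ⁅u, v⁆ ∈ F (j + 1) := by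
    intro u hu j v hv
    obtain ⟨a, w, hw, rfl⟩ := hM u hu
    rw [add_lie, hcommF w hw v (hF0 j hv), add_zero, smul_lie]
    exact Submodule.smul_mem _ _ (hxF j v hv)
  have hMM : ∀ u ∈ M, ∀ v ∈ M, ⁅u, v⁆ ∈ F 0 := by
    intro u hu v hv
    obtain ⟨a, w, hw, rfl⟩ := hM u hu
    obtain ⟨b, w', hw', rfl⟩ := hM v hv
    rw [lie_add]
    refine add_mem ?_ (hF0 1 (hMF _ hu 0 _ hw'))
    rw [lie_smul, add_lie, smul_lie, lie_self, smul_zero, zero_add, ← lie_skew]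
    exact Submodule.smul_mem _ _ (neg_mem (hF0 1 (hxF 0 w hw)))
  let K : LieSubalgebra k L :=
    { M with lie_mem' := fun {u v} hu hv => Submodule.mem_sup_right (hMM u hu v hv) }
  have hle : LieSubalgebra.lieSpan k L {x, y} ≤ K := by
    rw [LieSubalgebra.lieSpan_le]
    rintro u (rfl | rfl)
    · exact Submodule.mem_sup_left (Submodule.subset_span rfl)
    · exact Submodule.mem_sup_right (hF 0 0 le_rfl)
  have hfinF : FiniteDimensional k (F 0) := by
    have : F 0 ≤ Submodule.span k (z '' Set.Iio N) := by
      refine Submodule.span_le.mpr ?_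
      rintro _ ⟨i, -, rfl⟩
      rcases lt_or_ge i N with h | h
      · exact Submodule.subset_span ⟨i, h, rfl⟩
      · rw [SetLike.mem_coe, hz0 i h]; exact zero_mem _
    have hfin := FiniteDimensional.span_of_finite k ((Set.finite_Iio N).image z)
    exact Submodule.finiteDimensional_of_le this
  have hfinM : FiniteDimensional k M := inferInstance
  have hfin : FiniteDimensional k (LieSubalgebra.lieSpan k L {x, y}) :=
    Submodule.finiteDimensional_of_le (S₂ := M) hle
  -- Engel's theorem. The first bracket with `u` lands in `F 0` and each further one raises the
  -- filtration by one, whence `N + 1`.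
  refine ⟨hfin, (LieAlgebra.isNilpotent_iff_forall (R := k)).mpr fun u => ⟨N + 1, ?_⟩⟩
  have key : ∀ (n : ℕ) (v : LieSubalgebra.lieSpan k L {x, y}),
      ((((LieAlgebra.ad k _ u) ^ (n + 1)) v : LieSubalgebra.lieSpan k L {x, y}) : L) ∈ F n := by
    intro n v
    induction n with
    | zero => simpa using hMM _ (hle u.2) _ (hle v.2)
    | succ n ih =>
      rw [pow_succ', Module.End.mul_apply, LieAlgebra.ad_apply, LieSubalgebra.coe_bracket]
      exact hMF _ (hle u.2) n _ ih
  ext v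
  have := key N v
  rw [hFN, Submodule.mem_bot] at this
  rw [this]
  rfl

end LieSpanPair

/-! ### Brackets of monomial operators on Laurent polynomials -/

section MonomialDerivations

variable {k : Type*} [Field k] {G : Type*} [AddCommGroup G]

/-- The operator `χ^m ↦ p(m) χ^{m+e}` of a group algebra. -/
noncomputable def monomialOperator (k : Type*) [Field k] (e : G) (p : G →+ ℤ) :
    AddMonoidAlgebra k G →ₗ[k] AddMonoidAlgebra k G :=
  (Finsupp.linearCombination k fun m => AddMonoidAlgebra.single (m + e) ((p m : ℤ) : k)) ∘ₗ
    (AddMonoidAlgebra.coeffLinearEquiv k).toLinearMap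

theorem monomialOperator_single (e : G) (p : G →+ ℤ) (m : G) (c : k) :
    monomialOperator k e p (AddMonoidAlgebra.single m c) =
      AddMonoidAlgebra.single (m + e) (c * ((p m : ℤ) : k)) := by
  simp [monomialOperator]

theorem monomialOperator_zero (e : G) : monomialOperator k e (0 : G →+ ℤ) = 0 := by
  refine LinearMap.ext fun f => ?_
  induction f using AddMonoidAlgebra.induction_linear with
  | zero => simp
  | add f g hf hg => rw [map_add, hf, hg, map_add]
  | single m c => rw [monomialOperator_single]; simp

/-- The coefficient at `m` is `p(m + f) q(m) - q(m + e) p(m)`; the quadratic terms `p(m) q(m)`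
cancel, leaving a linear form again. -/
theorem monomialOperator_bracket (e f : G) (p q : G →+ ℤ) (a : AddMonoidAlgebra k G) :
    monomialOperator k e p (monomialOperator k f q a) -
      monomialOperator k f q (monomialOperator k e p a) =
      monomialOperator k (e + f) (p f • q - q e • p) a := by
  induction a using AddMonoidAlgebra.induction_linear with
  | zero => simp
  | add a b ha hb => simp only [map_add, ← ha, ← hb]; abel
  | single m c =>
    simp only [monomialOperator_single]
    rw [add_assoc, add_assoc, add_comm f e, ← AddMonoidAlgebra.single_sub]
    congr 1
    simp only [map_add, AddMonoidHom.sub_apply, AddMonoidHom.smul_apply, smul_eq_mul]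
    push_cast
    ring

variable {A : Type*} [CommRing A] [Algebra k A]

/-- Under the embedding `ι`, the derivation `D` acts as `χ^m ↦ p(m) χ^{m+e}`. -/
def ActsAsMonomial (ι : A →ₗ[k] AddMonoidAlgebra k G) (D : Derivation k A A) (e : G)
    (p : G →+ ℤ) : Prop :=
  ∀ a, ι (D a) = monomialOperator k e p (ι a)

variable {ι : A →ₗ[k] AddMonoidAlgebra k G} {D D' : Derivation k A A} {e f : G} {p q : G →+ ℤ}

theorem ActsAsMonomial.bracket (hD : ActsAsMonomial ι D e p) (hD' : ActsAsMonomial ι D' f q) :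
    ActsAsMonomial ι ⁅D, D'⁆ (e + f) (p f • q - q e • p) := by
  intro a
  rw [Derivation.commutator_apply, map_sub, hD, hD', hD', hD, monomialOperator_bracket]

theorem ActsAsMonomial.eq_zero (hι : Function.Injective ι) (hD : ActsAsMonomial ι D e p)
    (hp : p = 0) : D = 0 := by
  ext a
  apply hι
  rw [hD, hp, monomialOperator_zero, Derivation.zero_apply, map_zero, LinearMap.zero_apply]

theorem ActsAsMonomial.apply_eq_zero [CharZero k] (hD : ActsAsMonomial ι D e p) (h : D = 0) {m : G}
    (hm : AddMonoidAlgebra.single m (1 : k) ∈ LinearMap.range ι) : p m = 0 := by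
  obtain ⟨a, ha⟩ := hm
  have h1 := hD a
  rw [h, Derivation.zero_apply, map_zero, ha, monomialOperator_single, one_mul, eq_comm,
    AddMonoidAlgebra.single_eq_zero] at h1
  exact_mod_cast h1

/-- Produces further monomials in the image of `ι` at which a linear form can be tested. -/
theorem ActsAsMonomial.single_add_mem_range [CharZero k] (hD : ActsAsMonomial ι D e p) {m : G}
    (hm : AddMonoidAlgebra.single m (1 : k) ∈ LinearMap.range ι) (h : p m ≠ 0) :
    AddMonoidAlgebra.single (m + e) (1 : k) ∈ LinearMap.range ι := by
  obtain ⟨a, ha⟩ := hm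
  refine ⟨((p m : ℤ) : k)⁻¹ • D a, ?_⟩
  have h0 : ((p m : ℤ) : k) ≠ 0 := by exact_mod_cast h
  rw [map_smul, hD, ha, monomialOperator_single, AddMonoidAlgebra.smul_single, one_mul, smul_eq_mul,
    inv_mul_cancel₀ h0]

variable {D₁ D₂ : Derivation k A A} {e₁ e₂ : G} {ρ₁ ρ₂ : G →+ ℤ}

/-- A combination of `ρ₁` and `ρ₂` through which a vanishing derivation acts is trivial. -/
theorem eq_zero_of_actsAsMonomial_zero [CharZero k] (h₁ : ActsAsMonomial ι D₁ e₁ ρ₁)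
    (h₂ : ActsAsMonomial ι D₂ e₂ ρ₂) (h11 : ρ₁ e₁ = -1) (h22 : ρ₂ e₂ = -1) (h21 : 0 < ρ₂ e₁)
    {m : G} (hm : AddMonoidAlgebra.single m (1 : k) ∈ LinearMap.range ι)
    (hm₁ : 0 < ρ₁ m) (hm₂ : 0 < ρ₂ m) {D : Derivation k A A} {e : G} {a b : ℤ}
    (hD : ActsAsMonomial ι D e (a • ρ₁ + b • ρ₂)) (h : D = 0) : a = 0 ∧ b = 0 := by
  -- The form vanishes at `m`, `m + e₁` and `m + e₂`. The differences give `a = b ρ₂(e₁)` and `b = a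
  -- ρ₁(e₂)`, and the value at `m` then forces `b = 0` by positivity.
  have E0 := hD.apply_eq_zero h hm
  have E1 := hD.apply_eq_zero h (h₁.single_add_mem_range hm hm₁.ne')
  have E2 := hD.apply_eq_zero h (h₂.single_add_mem_range hm hm₂.ne')
  simp only [AddMonoidHom.add_apply, AddMonoidHom.smul_apply, smul_eq_mul, map_add, h11, h22]
    at E0 E1 E2
  have F1 : a = b * ρ₂ e₁ := by linarith
  have F2 : b = a * ρ₁ e₂ := by linarith
  have hb : b * (ρ₂ e₁ * ρ₁ m + ρ₂ m) = 0 := by rw [F1] at E0; linarith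
  have hpos : 0 < ρ₂ e₁ * ρ₁ m + ρ₂ m := by positivity
  have hb0 := (mul_eq_zero.mp hb).resolve_right hpos.ne'
  exact ⟨by rw [F1, hb0, zero_mul], hb0⟩

/-- If `⟨ρ₁, e₂⟩` and `⟨ρ₂, e₁⟩` are both positive, then `ad [D₁, D₂]` is not nilpotent on `D₁`. -/
theorem ad_bracket_pow_ne_zero [CharZero k] (h₁ : ActsAsMonomial ι D₁ e₁ ρ₁)
    (h₂ : ActsAsMonomial ι D₂ e₂ ρ₂) (h11 : ρ₁ e₁ = -1) (h22 : ρ₂ e₂ = -1)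
    (h12 : 0 < ρ₁ e₂) (hle : ρ₁ e₂ ≤ ρ₂ e₁) {m : G}
    (hm : AddMonoidAlgebra.single m (1 : k) ∈ LinearMap.range ι)
    (hm₁ : 0 < ρ₁ m) (hm₂ : 0 < ρ₂ m) (N : ℕ) :
    ((LieAlgebra.ad k (Derivation k A A) ⁅D₁, D₂⁆) ^ N) D₁ ≠ 0 := by
  have hH := h₁.bracket h₂
  set p := ρ₁ e₂ • ρ₂ - ρ₂ e₁ • ρ₁ with hp
  -- Modulo `p`, step `N` multiplies the coefficient `a` of `ρ₁` by `p(e₁ + N(e₁ + e₂)) = cd + c +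
  -- N(c - d)`, where `c = ρ₂ e₁` and `d = ρ₁ e₂`; this is positive because `0 < d ≤ c`.
  have key : ∀ N : ℕ, ∃ a b : ℤ, 0 < a ∧
      ActsAsMonomial ι (((LieAlgebra.ad k (Derivation k A A) ⁅D₁, D₂⁆) ^ N) D₁)
        (e₁ + N • (e₁ + e₂)) (a • ρ₁ + b • p) := by
    intro N
    induction N with
    | zero => exact ⟨1, 0, one_pos, by simpa using h₁⟩
    | succ N ih =>
      obtain ⟨a, b, ha, hab⟩ := ih
      have h := hH.bracket hab
      have hpos : 0 < p (e₁ + N • (e₁ + e₂)) := by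
        simp only [hp, AddMonoidHom.sub_apply, AddMonoidHom.smul_apply, map_add, map_nsmul, h11,
          h22, smul_eq_mul, nsmul_eq_mul]
        have : 0 ≤ (N : ℤ) * (ρ₂ e₁ - ρ₁ e₂) := by
          have : 0 ≤ ρ₂ e₁ - ρ₁ e₂ := by linarith
          positivity
        nlinarith [mul_pos h12 (h12.trans_le hle)]
      refine ⟨p (e₁ + N • (e₁ + e₂)) * a, p (e₁ + N • (e₁ + e₂)) * b - (a • ρ₁ + b • p) (e₁ + e₂),
        mul_pos hpos ha, ?_⟩
      rw [pow_succ', Module.End.mul_apply, LieAlgebra.ad_apply]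
      convert h using 1
      · rw [succ_nsmul]; abel
      · module
  intro h0
  obtain ⟨a, b, ha, hab⟩ := key N
  have hab' : a • ρ₁ + b • p = (a - b * ρ₂ e₁) • ρ₁ + (b * ρ₁ e₂) • ρ₂ := by
    rw [hp, smul_sub, smul_smul, smul_smul, sub_smul]; abel
  rw [hab'] at hab
  obtain ⟨E1, E2⟩ := eq_zero_of_actsAsMonomial_zero h₁ h₂ h11 h22 (h12.trans_le hle) hm hm₁ hm₂
    hab h0
  have hb := (mul_eq_zero.mp E2).resolve_right h12.ne'
  rw [hb] at E1
  linarith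

/-- If `⟨ρ₁, e₂⟩ = 0`, then `D₁` and `D₂` generate a finite-dimensional nilpotent Lie algebra. -/
theorem finiteDimensional_and_isNilpotent_lieGenerated (hι : Function.Injective ι)
    (h₁ : ActsAsMonomial ι D₁ e₁ ρ₁)
    (h₂ : ActsAsMonomial ι D₂ e₂ ρ₂) (h11 : ρ₁ e₁ = -1) (h22 : ρ₂ e₂ = -1) (h12 : ρ₁ e₂ = 0)
    (h21 : 0 ≤ ρ₂ e₁) : FiniteDimensional k (lieGenerated D₁ D₂) ∧
      LieRing.IsNilpotent (lieGenerated D₁ D₂) := by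
  -- Since `ρ₁ e₂ = 0`, no multiple of `ρ₂` ever appears, and the new factor at step `i` is `ρ₂(e₁ +
  -- i e₂) = ρ₂ e₁ - i`.
  have key : ∀ i : ℕ, ActsAsMonomial ι (((LieAlgebra.ad k (Derivation k A A) D₂) ^ i) D₁)
      (e₁ + i • e₂) ((∏ j ∈ Finset.range i, (ρ₂ e₁ - j)) • ρ₁) := by
    intro i
    induction i with
    | zero => simpa using h₁
    | succ i ih =>
      have h := h₂.bracket ih
      rw [pow_succ', Module.End.mul_apply, LieAlgebra.ad_apply]
      convert h using 1
      · rw [succ_nsmul]; abel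
      · rw [Finset.prod_range_succ]
        simp only [AddMonoidHom.smul_apply, map_add, map_nsmul, h12, h22, smul_zero, zero_smul,
          sub_zero, smul_smul, nsmul_eq_mul]
        congr 1
        ring
  have hpair := finiteDimensional_and_isNilpotent_lieSpan_pair (k := k) D₂ D₁ (fun i j => ?_)
    (N := (ρ₂ e₁).toNat + 1) ?_
  · rw [Set.pair_comm] at hpair
    exact hpair
  -- Both forms are multiples of `ρ₁`, which takes the value `-1` at every `e₁ + i e₂`, so the two
  -- terms of the bracket cancel.
  · refine ((key i).bracket (key j)).eq_zero hι ?_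
    ext m
    simp only [AddMonoidHom.sub_apply, AddMonoidHom.smul_apply, map_add, map_nsmul, h11, h12,
      smul_eq_mul, AddMonoidHom.zero_apply]
    ring
  · refine (key _).eq_zero hι ?_
    rw [Finset.prod_eq_zero (i := (ρ₂ e₁).toNat) (by simp), zero_smul]
    rw [Int.toNat_of_nonneg h21, sub_self]

end MonomialDerivations

/-! ### Recognizing unipotent algebraic groups from a parametrization -/

section Criterion

variable {k : Type*} [Field k] {A : Type*} [CommRing A] [Algebra k A]

/-- A group `G` of automorphisms is a unipotent algebraic group if it consists of locally unipotent
automorphisms and is parametrized by an affine space, polynomially and in such a way that the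
parameters can be read off linearly. -/
theorem isUnipotentAlgebraicGroup_of_parametrization {σ : Type*} [Finite σ]
    (G : Subgroup (A ≃ₐ[k] A)) (F : (σ → k) → (A ≃ₐ[k] A)) (hrange : Set.range F = G)
    (hreg : ∀ f : A, ∃ (q : ℕ) (P : Fin q → MvPolynomial σ k) (a : Fin q → A), ∀ t,
      F t f = ∑ l, MvPolynomial.eval t (P l) • a l)
    (f : σ → A) (μ : σ → Module.Dual k A) (hμ : ∀ t i, μ i (F t (f i) - f i) = t i)
    (hunip : ∀ g ∈ G, ∀ a : A, ∃ n : ℕ, ((g.toLinearMap - 1 : Module.End k A) ^ n) a = 0) :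
    IsUnipotentAlgebraicGroup G := by
  classical
  have hFG : ∀ t, F t ∈ G := fun t => by
    rw [← SetLike.mem_coe, ← hrange]; exact ⟨t, rfl⟩
  have hGF : ∀ g ∈ G, ∃ t, F t = g := fun g hg => by
    rwa [← SetLike.mem_coe, ← hrange] at hg
  -- The span of the orbits of the `f i` is `G`-stable, finite-dimensional by polynomiality in `t`,
  -- and faithful because `μ` recovers `t` from `F t (f i)`. It gives the embedding into `GL`.
  let V : Submodule k A := Submodule.span k {a | ∃ t i, a = F t (f i)}
  have hfV : ∀ i, f i ∈ V := fun i => by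
    obtain ⟨t, ht⟩ := hGF 1 (one_mem G)
    exact Submodule.subset_span ⟨t, i, by rw [ht]; rfl⟩
  have hV : ∀ g ∈ G, ∀ v ∈ V, g.toLinearMap v ∈ V := by
    intro g hg v hv
    induction hv using Submodule.span_induction with
    | mem v hv =>
      obtain ⟨t, i, rfl⟩ := hv
      obtain ⟨t', ht'⟩ := hGF _ (mul_mem hg (hFG t))
      exact Submodule.subset_span ⟨t', i, by rw [ht']; rfl⟩
    | zero => rw [map_zero]; exact zero_mem _
    | add v w _ _ h1 h2 => rw [map_add]; exact add_mem h1 h2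
    | smul c v _ h1 => rw [map_smul]; exact Submodule.smul_mem _ _ h1
  have hfin : FiniteDimensional k V := by
    choose q P a hP using fun i => hreg (f i)
    have hle : V ≤ Submodule.span k (Set.range fun p : Σ i, Fin (q i) => a p.1 p.2) := by
      refine Submodule.span_le.mpr ?_
      rintro _ ⟨t, i, rfl⟩
      rw [SetLike.mem_coe, hP]
      exact Submodule.sum_mem _ fun l _ => Submodule.smul_mem _ _ (Submodule.subset_span ⟨⟨i, l⟩, rfl⟩)
    have := FiniteDimensional.span_of_finite k
      (Set.finite_range fun p : Σ i, Fin (q i) => a p.1 p.2)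
    exact Submodule.finiteDimensional_of_le hle
  let m := Module.finrank k V
  let b : Module.Basis (Fin m) k V := Module.finBasis k V
  let res : G →* Module.End k V :=
    { toFun := fun g => g.1.toLinearMap.restrict (hV g.1 g.2)
      map_one' := rfl
      map_mul' := fun _ _ => rfl }
  let ψ₀ : G →* Matrix (Fin m) (Fin m) k :=
    (LinearMap.toMatrixAlgEquiv b).toMulEquiv.toMonoidHom.comp res
  let ψ : G →* GL (Fin m) k := ψ₀.toHomUnits
  have hψ : ∀ g, ((ψ g : GL (Fin m) k) : Matrix (Fin m) (Fin m) k) =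
      LinearMap.toMatrixAlgEquiv b (res g) := fun g => rfl
  have hinj : Function.Injective ψ := by
    intro g g' h
    have h1 : res g = res g' := by
      apply (LinearMap.toMatrixAlgEquiv b).injective
      rw [← hψ, ← hψ, h]
    obtain ⟨t, ht⟩ := hGF g.1 g.2
    obtain ⟨t', ht'⟩ := hGF g'.1 g'.2
    have htt : t = t' := by
      funext i
      have h2 : F t (f i) = F t' (f i) := by
        rw [ht, ht']
        exact congrArg Subtype.val (LinearMap.congr_fun h1 ⟨f i, hfV i⟩)
      rw [← hμ t i, ← hμ t' i, h2]
    exact Subtype.ext (by rw [← ht, ← ht', htt])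
  -- the parameters are polynomials in the matrix entries
  obtain ⟨R, hR⟩ : ∃ R : σ → MvPolynomial (Fin m × Fin m) k, ∀ t i,
      MvPolynomial.eval (fun ij => ((ψ ⟨F t, hFG t⟩ : GL (Fin m) k) :
        Matrix (Fin m) (Fin m) k) ij.1 ij.2) (R i) = t i := by
    refine ⟨fun i => ∑ j, ∑ l, MvPolynomial.C (b.repr ⟨f i, hfV i⟩ j * μ i (b l)) *
      MvPolynomial.X (l, j) - MvPolynomial.C (μ i (f i)), fun t i => ?_⟩
    have h1 : F t (f i) = ∑ j, ∑ l, (b.repr ⟨f i, hfV i⟩ j *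
        LinearMap.toMatrixAlgEquiv b (res ⟨F t, hFG t⟩) l j) • (b l : A) := by
      have h2 : F t (f i) = (res ⟨F t, hFG t⟩ ⟨f i, hfV i⟩ : V) := rfl
      rw [h2]
      conv_lhs => rw [← b.sum_repr ⟨f i, hfV i⟩]
      rw [map_sum, Submodule.coe_sum]
      refine Finset.sum_congr rfl fun j _ => ?_
      rw [map_smul]
      conv_lhs => rw [← b.sum_repr (res ⟨F t, hFG t⟩ (b j))]
      rw [Finset.smul_sum, Submodule.coe_sum]
      refine Finset.sum_congr rfl fun l _ => ?_
      rw [smul_smul, LinearMap.toMatrixAlgEquiv_apply]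
      rfl
    rw [← hμ t i, map_sub, map_sub, h1, MvPolynomial.eval_C]
    simp only [map_sum, map_mul, MvPolynomial.eval_C, MvPolynomial.eval_X, map_smul, smul_eq_mul, hψ]
    congr 1
    refine Finset.sum_congr rfl fun j _ => Finset.sum_congr rfl fun l _ => ?_
    ring
  -- the matrix entries are polynomials in the parameters
  obtain ⟨Q, hQ⟩ : ∃ Q : Fin m → Fin m → MvPolynomial σ k, ∀ t l j,
      ((ψ ⟨F t, hFG t⟩ : GL (Fin m) k) : Matrix (Fin m) (Fin m) k) l j =
        MvPolynomial.eval t (Q l j) := by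
    choose q P a hP using fun j => hreg (b j : A)
    choose ν hν using fun l => LinearMap.exists_extend (b.coord l)
    refine ⟨fun l j => ∑ s, MvPolynomial.C (ν l (a j s)) * P j s, fun t l j => ?_⟩
    rw [hψ, LinearMap.toMatrixAlgEquiv_apply]
    have h1 : b.repr (res ⟨F t, hFG t⟩ (b j)) l = ν l (F t (b j)) :=
      (LinearMap.congr_fun (hν l) (res ⟨F t, hFG t⟩ (b j))).symm
    rw [h1, hP, map_sum, map_sum]
    refine Finset.sum_congr rfl fun s _ => ?_
    rw [map_smul, map_mul, MvPolynomial.eval_C, smul_eq_mul, mul_comm]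
  have hbind : ∀ (x : Fin m × Fin m → k) (p : MvPolynomial σ k),
      MvPolynomial.eval x (MvPolynomial.bind₁ R p) =
        MvPolynomial.eval (fun i => MvPolynomial.eval x (R i)) p := by
    intro x p
    rw [MvPolynomial.eval, MvPolynomial.eval₂Hom_bind₁]
    rfl
  let e := MonoidHom.ofInjective hinj
  refine ⟨m, ψ.range, G.subtype.comp e.symm.toMonoidHom, ⟨?_, ?_⟩, ?_, ?_, ?_⟩
  -- Closedness: with `R` reading parameters off a matrix and `Q` building the matrix back, the
  -- image is the locus `x = Q (R x)`.
  · refine ⟨Set.range fun lj : Fin m × Fin m =>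
      MvPolynomial.X lj - MvPolynomial.bind₁ R (Q lj.1 lj.2), fun g => ⟨?_, fun h => ?_⟩⟩
    · rintro ⟨⟨g', hg'⟩, rfl⟩ _ ⟨⟨l, j⟩, rfl⟩
      obtain ⟨t, rfl⟩ := hGF g' hg'
      rw [map_sub, MvPolynomial.eval_X, hbind, funext (hR t), hQ, sub_self]
    · refine ⟨⟨F _, hFG fun i => MvPolynomial.eval (fun ij : Fin m × Fin m =>
        (g : Matrix (Fin m) (Fin m) k) ij.1 ij.2) (R i)⟩, Units.ext (Matrix.ext fun l j => ?_)⟩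
      have h1 := h _ ⟨(l, j), rfl⟩
      rw [map_sub, MvPolynomial.eval_X, hbind, sub_eq_zero] at h1
      rw [hQ, h1]
  · rintro _ ⟨g, rfl⟩
    have h1 : IsNilpotent (res g - 1) := by
      choose n hn using fun j => hunip g.1 g.2 (b j : A)
      -- The sum is a single exponent that works for all basis vectors, upgrading local unipotence
      -- to nilpotency on `V`.
      refine ⟨∑ j, n j, b.ext fun j => ?_⟩
      have h2 : ∀ (s : ℕ) (v : V), (((res g - 1) ^ s) v : A) =
          ((g.1.toLinearMap - 1 : Module.End k A) ^ s) v := by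
        intro s
        induction s with
        | zero => intro v; rfl
        | succ s ih =>
          intro v
          rw [pow_succ, pow_succ, Module.End.mul_apply, Module.End.mul_apply, ih]
          rfl
      apply Subtype.ext
      rw [h2, ← Nat.sub_add_cancel (Finset.single_le_sum (f := n) (fun _ _ => Nat.zero_le _)
        (Finset.mem_univ j)), pow_add, Module.End.mul_apply, hn, map_zero]
      rfl
    obtain ⟨N, hN⟩ := h1
    refine ⟨N, ?_⟩
    rw [hψ, ← map_one (LinearMap.toMatrixAlgEquiv b), ← map_sub, ← map_pow, hN, map_zero]
  · intro x
    obtain ⟨q, P, a, hP⟩ := hreg x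
    refine ⟨q, fun l => MvPolynomial.bind₁ R (P l), a, fun u => ?_⟩
    obtain ⟨⟨g, hg⟩, rfl⟩ := e.surjective u
    obtain ⟨t, rfl⟩ := hGF g hg
    have h1 : (G.subtype.comp e.symm.toMonoidHom) (e ⟨F t, hg⟩) = F t := by
      change ((e.symm (e ⟨F t, hg⟩) : G) : A ≃ₐ[k] A) = F t
      rw [MulEquiv.symm_apply_apply]
    rw [h1, hP]
    refine Finset.sum_congr rfl fun l _ => ?_
    have h2 : MvPolynomial.eval (fun ij : Fin m × Fin m => (((e ⟨F t, hg⟩ : ψ.range) : GL (Fin m) k) :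
        Matrix (Fin m) (Fin m) k) ij.1 ij.2) (MvPolynomial.bind₁ R (P l)) =
          MvPolynomial.eval t (P l) := by
      rw [hbind]
      exact congrArg (fun x => MvPolynomial.eval x (P l)) (funext (hR t))
    rw [h2]
  · exact Subtype.val_injective.comp e.symm.injective
  · rw [MonoidHom.range_comp]
    have : e.symm.toMonoidHom.range = ⊤ := MonoidHom.range_eq_top.mpr e.symm.surjective
    rw [this, ← MonoidHom.range_eq_map, Subgroup.range_subtype]

end Criterion

/-! ### Locally unipotent algebra endomorphisms -/

section LocallyUnipotent

variable {k : Type*} [Field k] {A : Type*} [CommRing A] [Algebra k A]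

/-- For `δ = g - 1` the twisted Leibniz rule `δ(xy) = δx δy + δx y + x δy` holds, and each term
lowers the sum of the nilpotency orders. Hence local unipotence need only be checked on algebra
generators. -/
theorem pow_sub_one_mul_eq_zero (g : A →ₐ[k] A) : ∀ (N a b : ℕ) (x y : A), a + b ≤ N →
    ((g.toLinearMap - 1 : Module.End k A) ^ a) x = 0 →
    ((g.toLinearMap - 1 : Module.End k A) ^ b) y = 0 →
    ((g.toLinearMap - 1 : Module.End k A) ^ N) (x * y) = 0 := by
  set δ : Module.End k A := g.toLinearMap - 1 with hδ
  have hmul : ∀ x y, δ (x * y) = δ x * δ y + δ x * y + x * δ y := by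
    intro x y
    simp only [hδ, LinearMap.sub_apply, AlgHom.toLinearMap_apply, map_mul, Module.End.one_apply]
    ring
  intro N
  induction N with
  | zero =>
    intro a b x y hab hx _
    obtain rfl : a = 0 := by omega
    have hx' : x = 0 := hx
    rw [hx', zero_mul, map_zero]
  | succ N ih =>
    intro a b x y hab hx hy
    rcases a with _ | a
    · have hx' : x = 0 := hx
      rw [hx', zero_mul, map_zero]
    rcases b with _ | b
    · have hy' : y = 0 := hy
      rw [hy', mul_zero, map_zero]
    have hx' : (δ ^ a) (δ x) = 0 := by rwa [pow_succ] at hx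
    have hy' : (δ ^ b) (δ y) = 0 := by rwa [pow_succ] at hy
    rw [pow_succ, Module.End.mul_apply, hmul, map_add, map_add,
      ih a b _ _ (by omega) hx' hy', ih a (b + 1) _ _ (by omega) hx' hy,
      ih (a + 1) b _ _ (by omega) hx hy', add_zero, add_zero]

/-- The subalgebra of elements on which `g` acts unipotently. -/
def locallyUnipotentSubalgebra (g : A →ₐ[k] A) : Subalgebra k A where
  carrier := {x | ∃ n : ℕ, ((g.toLinearMap - 1 : Module.End k A) ^ n) x = 0}
  mul_mem' := by
    rintro x y ⟨a, ha⟩ ⟨b, hb⟩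
    exact ⟨a + b, pow_sub_one_mul_eq_zero g _ a b x y le_rfl ha hb⟩
  add_mem' := by
    rintro x y ⟨a, ha⟩ ⟨b, hb⟩
    refine ⟨a + b, ?_⟩
    rw [map_add]
    nth_rw 1 [add_comm a b]
    rw [pow_add, pow_add, Module.End.mul_apply, Module.End.mul_apply, ha, hb, map_zero, map_zero,
      add_zero]
  algebraMap_mem' c := ⟨1, by simp⟩

theorem mem_locallyUnipotentSubalgebra_of_sub_mem {g : A →ₐ[k] A} {x : A}
    (h : g x - x ∈ locallyUnipotentSubalgebra g) : x ∈ locallyUnipotentSubalgebra g := by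
  obtain ⟨n, hn⟩ := h
  refine ⟨n + 1, ?_⟩
  rw [pow_succ]
  exact hn

theorem mem_locallyUnipotentSubalgebra_of_fixed {g : A →ₐ[k] A} {x : A} (h : g x = x) :
    x ∈ locallyUnipotentSubalgebra g :=
  mem_locallyUnipotentSubalgebra_of_sub_mem (by rw [h, sub_self]; exact zero_mem _)

end LocallyUnipotent

/-! ### Families of endomorphisms polynomial in their parameters -/

section PolynomialFamilies

variable {k : Type*} [Field k] {σ τ : Type*}

/-- A family of endomorphisms of a polynomial ring is polynomial in its parameters if the images of
the variables are. -/
theorem exists_eval_smul_of_forall_X (F : (τ → k) → (MvPolynomial σ k →ₐ[k] MvPolynomial σ k))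
    (hF : ∀ i, ∃ p : MvPolynomial τ (MvPolynomial σ k), ∀ t,
      F t (MvPolynomial.X i) = MvPolynomial.aeval (fun j => MvPolynomial.C (t j)) p)
    (f : MvPolynomial σ k) :
    ∃ (q : ℕ) (P : Fin q → MvPolynomial τ k) (a : Fin q → MvPolynomial σ k), ∀ t,
      F t f = ∑ l, MvPolynomial.eval t (P l) • a l := by
  have key : ∃ p : MvPolynomial τ (MvPolynomial σ k), ∀ t,
      F t f = MvPolynomial.aeval (fun j => (MvPolynomial.C (t j) : MvPolynomial σ k)) p := by
    induction f using MvPolynomial.induction_on with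
    | C c =>
      refine ⟨MvPolynomial.C (MvPolynomial.C c), fun t => ?_⟩
      rw [MvPolynomial.aeval_C, ← MvPolynomial.algebraMap_eq, AlgHom.commutes]
      rfl
    | add f g hf hg =>
      obtain ⟨p, hp⟩ := hf
      obtain ⟨q, hq⟩ := hg
      exact ⟨p + q, fun t => by rw [map_add, map_add, hp, hq]⟩
    | mul_X f i hf =>
      obtain ⟨p, hp⟩ := hf
      obtain ⟨q, hq⟩ := hF i
      exact ⟨p * q, fun t => by rw [map_mul, map_mul, hp, hq]⟩
  obtain ⟨p, hp⟩ := key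
  -- Expanding `p` by its monomials in the parameters separates them from its coefficients, which
  -- lie in the polynomial ring.
  let e := p.support.equivFin
  refine ⟨p.support.card, fun l => MvPolynomial.monomial (e.symm l : τ →₀ ℕ) 1,
    fun l => p.coeff (e.symm l : τ →₀ ℕ), fun t => ?_⟩
  rw [hp, MvPolynomial.aeval_eq_eval₂Hom, MvPolynomial.coe_eval₂Hom, MvPolynomial.eval₂_eq,
    ← Finset.sum_coe_sort, ← e.symm.sum_comp]
  refine Finset.sum_congr rfl fun l _ => ?_
  rw [MvPolynomial.eval_monomial, one_mul, MvPolynomial.smul_eq_C_mul, mul_comm]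
  congr 1
  rw [Finsupp.prod, map_prod]
  exact Finset.prod_congr rfl fun j _ => (map_pow _ _ _).symm

end PolynomialFamilies

/-! ### The triangular group generated by two root subgroups of a polynomial ring -/

section ErasedDerivations

variable {k : Type*} [Field k] {σ : Type*} [Fintype σ] [DecidableEq σ]

/-- The monomial `∏_{l ≠ i} x_l ^ a_l`. -/
noncomputable def erasedMonomial (k : Type*) [Field k] {σ : Type*} [Fintype σ] [DecidableEq σ]
    (a : σ → ℕ) (i : σ) : MvPolynomial σ k :=
  ∏ l ∈ Finset.univ.erase i, MvPolynomial.X l ^ a l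

/-- The derivation `(∏_{l ≠ i} x_l ^ a_l) ∂/∂x_i`. -/
noncomputable def erasedDerivation (k : Type*) [Field k] {σ : Type*} [Fintype σ] [DecidableEq σ]
    (a : σ → ℕ) (i : σ) : Derivation k (MvPolynomial σ k) (MvPolynomial σ k) :=
  erasedMonomial k a i • MvPolynomial.pderiv i

theorem erasedMonomial_ne_zero (a : σ → ℕ) (i : σ) : erasedMonomial k a i ≠ 0 :=
  Finset.prod_ne_zero_iff.mpr fun l _ => pow_ne_zero _ (MvPolynomial.X_ne_zero l)

theorem algHom_erasedMonomial_congr {a : σ → ℕ} {i : σ}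
    {g h : MvPolynomial σ k →ₐ[k] MvPolynomial σ k}
    (H : ∀ l, l ≠ i → g (MvPolynomial.X l) = h (MvPolynomial.X l)) :
    g (erasedMonomial k a i) = h (erasedMonomial k a i) := by
  simp only [erasedMonomial, map_prod, map_pow]
  exact Finset.prod_congr rfl fun l hl => by rw [H l (Finset.ne_of_mem_erase hl)]

/-- When `b i = 0`, neither `x_i` nor `x_j` occurs in the monomial. -/
theorem algHom_erasedMonomial_of_fixed {b : σ → ℕ} {i j : σ} (hb : b i = 0)
    {g : MvPolynomial σ k →ₐ[k] MvPolynomial σ k}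
    (H : ∀ l, l ≠ i → l ≠ j → g (MvPolynomial.X l) = MvPolynomial.X l) :
    g (erasedMonomial k b j) = erasedMonomial k b j := by
  simp only [erasedMonomial, map_prod, map_pow]
  refine Finset.prod_congr rfl fun l hl => ?_
  by_cases hli : l = i
  · rw [hli, hb, pow_zero, pow_zero]
  · rw [H l hli (Finset.ne_of_mem_erase hl)]

theorem erasedDerivation_X_self (a : σ → ℕ) (i : σ) :
    erasedDerivation k a i (MvPolynomial.X i) = erasedMonomial k a i := by
  simp [erasedDerivation]

theorem erasedDerivation_X_of_ne (a : σ → ℕ) {i l : σ} (h : l ≠ i) :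
    erasedDerivation k a i (MvPolynomial.X l) = 0 := by
  simp [erasedDerivation, MvPolynomial.pderiv_X_of_ne h]

theorem erasedDerivation_erasedMonomial (a : σ → ℕ) (i : σ) :
    erasedDerivation k a i (erasedMonomial k a i) = 0 := by
  refine Finset.prod_induction _ (fun f => erasedDerivation k a i f = 0) ?_ (by simp) ?_
  · intro f g hf hg
    simp [Derivation.leibniz, hf, hg]
  · intro l hl
    rw [Derivation.leibniz_pow, erasedDerivation_X_of_ne a (Finset.ne_of_mem_erase hl)]
    simp

variable {a b : σ → ℕ} {i j : σ}

/-- `g` translates `x_j` by `t ∏_{l ≠ j} x_l ^ b_l` and fixes the variables other than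
`x_i`, `x_j`. -/
def IsTranslation (b : σ → ℕ) (i j : σ) (g : MvPolynomial σ k →ₐ[k] MvPolynomial σ k) (t : k) :
    Prop :=
  g (MvPolynomial.X j) = MvPolynomial.X j + t • erasedMonomial k b j ∧
    ∀ l, l ≠ i → l ≠ j → g (MvPolynomial.X l) = MvPolynomial.X l

theorem IsTranslation.mul (hb : b i = 0) {g h : MvPolynomial σ k ≃ₐ[k] MvPolynomial σ k} {s t : k}
    (hg : IsTranslation b i j g.toAlgHom s) (hh : IsTranslation b i j h.toAlgHom t) :
    IsTranslation b i j (g * h).toAlgHom (s + t) := by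
  refine ⟨?_, fun l hl hlj => ?_⟩
  · change g.toAlgHom (h.toAlgHom _) = _
    rw [hh.1, map_add, map_smul, hg.1, algHom_erasedMonomial_of_fixed hb hg.2, add_smul]
    abel
  · change g.toAlgHom (h.toAlgHom _) = _
    rw [hh.2 l hl hlj, hg.2 l hl hlj]

theorem IsTranslation.inv (hb : b i = 0) {g : MvPolynomial σ k ≃ₐ[k] MvPolynomial σ k} {t : k}
    (hg : IsTranslation b i j g.toAlgHom t) : IsTranslation b i j (g⁻¹).toAlgHom (-t) := by
  refine ⟨?_, fun l hl hlj => ?_⟩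
  · apply g.injective
    change g (g.symm _) = g.toAlgHom _
    rw [AlgEquiv.apply_symm_apply, map_add, map_smul, hg.1,
      algHom_erasedMonomial_of_fixed hb hg.2, neg_smul]
    abel
  · apply g.injective
    change g (g.symm _) = g.toAlgHom _
    rw [AlgEquiv.apply_symm_apply, hg.2 l hl hlj]

theorem algEquiv_eq_of_isTranslation {g h : MvPolynomial σ k ≃ₐ[k] MvPolynomial σ k} {t : k}
    (hg : IsTranslation b i j g.toAlgHom t) (hh : IsTranslation b i j h.toAlgHom t)
    (hi : g (MvPolynomial.X i) = h (MvPolynomial.X i)) : g = h := by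
  have : g.toAlgHom = h.toAlgHom := by
    refine MvPolynomial.algHom_ext fun l => ?_
    by_cases hli : l = i
    · rw [hli]; exact hi
    by_cases hlj : l = j
    · rw [hlj, hg.1, hh.1]
    · rw [hg.2 l hli hlj, hh.2 l hli hlj]
  exact AlgEquiv.ext fun f => AlgHom.congr_fun this f

variable [CharZero k]

theorem expAut_smul_apply_of_apply_apply_eq_zero {A : Type*} [CommRing A] [Algebra k A]
    (D : Derivation k A A) (hD : IsLocallyNilpotent D) (t : k) {x : A} (h : D (D x) = 0) :
    expAut (t • D) (hD.smul t) x = x + t • D x := by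
  change expFun (t • D) x = _
  rw [expFun_eq_sum (t • D) (N := 2) (by rw [smul_iterate]; simp [h])]
  simp [Finset.sum_range_succ]

theorem expAut_erasedDerivation_X_self (h : IsLocallyNilpotent (erasedDerivation k a i)) (t : k) :
    expAut (t • erasedDerivation k a i) (h.smul t) (MvPolynomial.X i) =
      MvPolynomial.X i + t • erasedMonomial k a i := by
  rw [expAut_smul_apply_of_apply_apply_eq_zero _ h, erasedDerivation_X_self]
  rw [erasedDerivation_X_self, erasedDerivation_erasedMonomial]

theorem expAut_erasedDerivation_X_of_ne (h : IsLocallyNilpotent (erasedDerivation k a i)) (t : k)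
    {l : σ} (hl : l ≠ i) :
    expAut (t • erasedDerivation k a i) (h.smul t) (MvPolynomial.X l) = MvPolynomial.X l := by
  rw [expAut_smul_apply_of_apply_apply_eq_zero _ h, erasedDerivation_X_of_ne a hl, smul_zero,
    add_zero]
  rw [erasedDerivation_X_of_ne a hl, map_zero]

theorem isTranslation_expAut (hij : i ≠ j) (h₂ : IsLocallyNilpotent (erasedDerivation k b j))
    (t : k) :
    IsTranslation b i j (expAut (t • erasedDerivation k b j) (h₂.smul t)).toAlgHom t ∧
      expAut (t • erasedDerivation k b j) (h₂.smul t) (MvPolynomial.X i) = MvPolynomial.X i :=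
  ⟨⟨expAut_erasedDerivation_X_self h₂ t, fun _ _ hl => expAut_erasedDerivation_X_of_ne h₂ t hl⟩,
    expAut_erasedDerivation_X_of_ne h₂ t hij⟩

/-- The span of the translates of `∏_{l ≠ i} x_l ^ a_l` under the flow of the derivation
`(∏_{l ≠ j} x_l ^ b_l) ∂/∂x_j`. -/
noncomputable def translateSpan (a : σ → ℕ) (i : σ)
    (h₂ : IsLocallyNilpotent (erasedDerivation k b j)) : Submodule k (MvPolynomial σ k) :=
  Submodule.span k (Set.range fun t : k =>
    expAut (t • erasedDerivation k b j) (h₂.smul t) (erasedMonomial k a i))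

variable (h₂ : IsLocallyNilpotent (erasedDerivation k b j))

/-- By local nilpotency the translates of a fixed monomial form a polynomial in `t`, so they lie in
the span of its finitely many coefficients. -/
theorem finiteDimensional_translateSpan : FiniteDimensional k (translateSpan a i h₂) := by
  obtain ⟨N, -, hN⟩ := evaluatesTo_expAut _ h₂ (erasedMonomial k a i)
  set S := PowerSeries.mk fun n => ((n.factorial : k)⁻¹) •
    (erasedDerivation k b j : Module.End k (MvPolynomial σ k)) ^ n
  have hle : translateSpan a i h₂ ≤ Submodule.span k
      ((fun n => PowerSeries.coeff n S (erasedMonomial k a i)) '' Set.Iio N) := by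
    refine Submodule.span_le.mpr ?_
    rintro _ ⟨t, rfl⟩
    simp only [hN]
    exact Submodule.sum_mem _ fun n hn => Submodule.smul_mem _ _
      (Submodule.subset_span ⟨n, Finset.mem_range.mp hn, rfl⟩)
  have := FiniteDimensional.span_of_finite k
    ((Set.finite_Iio N).image fun n => PowerSeries.coeff n S (erasedMonomial k a i))
  exact Submodule.finiteDimensional_of_le hle

/-- The translated monomial does not involve `x_i`, and away from `x_i` the map `g` coincides with
the flow at time `t`; so `g` carries the translate at `s` to the translate at `s + t`. -/
theorem IsTranslation.apply_mem_translateSpan (hij : i ≠ j) (hb : b i = 0)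
    {g : MvPolynomial σ k →ₐ[k] MvPolynomial σ k} {t : k} (hg : IsTranslation b i j g t)
    {w : MvPolynomial σ k} (hw : w ∈ translateSpan a i h₂) : g w ∈ translateSpan a i h₂ := by
  induction hw using Submodule.span_induction with
  | mem w hw =>
    obtain ⟨s, rfl⟩ := hw
    refine Submodule.subset_span ⟨s + t, ?_⟩
    refine algHom_erasedMonomial_congr (i := i)
      (g := (expAut ((s + t) • erasedDerivation k b j) (h₂.smul (s + t))).toAlgHom)
      (h := g.comp (expAut (s • erasedDerivation k b j) (h₂.smul s)).toAlgHom) fun l hl => ?_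
    by_cases hlj : l = j
    · subst hlj
      have h1 := (isTranslation_expAut hij h₂ (s + t)).1.1
      have h2 := (isTranslation_expAut hij h₂ s).1.1
      rw [AlgHom.comp_apply, h1, h2, map_add, map_smul, hg.1,
        algHom_erasedMonomial_of_fixed hb hg.2, add_smul]
      abel
    · have h1 := (isTranslation_expAut hij h₂ (s + t)).1.2 l hl hlj
      have h2 := (isTranslation_expAut hij h₂ s).1.2 l hl hlj
      rw [AlgHom.comp_apply, h1, h2, hg.2 l hl hlj]
  | zero => rw [map_zero]; exact zero_mem _
  | add v w _ _ h1 h2 => rw [map_add]; exact add_mem h1 h2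
  | smul c v _ h1 => rw [map_smul]; exact Submodule.smul_mem _ _ h1

/-- The translation moves `x_j` by a monomial free of `x_i` (as `b i = 0`), so no element of the
span involves `x_i`. -/
theorem apply_eq_self_of_mem_translateSpan (hij : i ≠ j) (hb : b i = 0)
    {g : MvPolynomial σ k →ₐ[k] MvPolynomial σ k}
    (hg : ∀ l, l ≠ i → g (MvPolynomial.X l) = MvPolynomial.X l)
    {w : MvPolynomial σ k} (hw : w ∈ translateSpan a i h₂) : g w = w := by
  induction hw using Submodule.span_induction with
  | mem w hw =>
    obtain ⟨s, rfl⟩ := hw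
    refine algHom_erasedMonomial_congr (i := i)
      (g := g.comp (expAut (s • erasedDerivation k b j) (h₂.smul s)).toAlgHom)
      (h := (expAut (s • erasedDerivation k b j) (h₂.smul s)).toAlgHom) fun l hl => ?_
    by_cases hlj : l = j
    · subst hlj
      have h2 := (isTranslation_expAut hij h₂ s).1.1
      rw [AlgHom.comp_apply, h2, map_add, map_smul, hg _ hl,
        algHom_erasedMonomial_of_fixed hb fun l hl _ => hg l hl]
    · have h2 := (isTranslation_expAut hij h₂ s).1.2 l hl hlj
      rw [AlgHom.comp_apply, h2, hg l hl]
  | zero => rw [map_zero]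
  | add v w _ _ h1 h2 => rw [map_add, h1, h2]
  | smul c v _ h1 => rw [map_smul, h1]

variable (h₁ : IsLocallyNilpotent (erasedDerivation k a i))

/-- The maps of this triangular shape contain both root subgroups and are closed under products and
inverses, because translations preserve `translateSpan`. In effect they form a semidirect product of
that vector group with `k`. -/
theorem exists_of_mem_groupGenerated_erasedDerivation (hij : i ≠ j) (hb : b i = 0)
    {g : MvPolynomial σ k ≃ₐ[k] MvPolynomial σ k}
    (hg : g ∈ groupGenerated (erasedDerivation k a i) (erasedDerivation k b j) h₁ h₂) :
    ∃ t, ∃ w ∈ translateSpan a i h₂, IsTranslation b i j g.toAlgHom t ∧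
      g (MvPolynomial.X i) = MvPolynomial.X i + w := by
  induction hg using Subgroup.closure_induction with
  | mem g hg =>
    rcases hg with ⟨t, rfl⟩ | ⟨t, rfl⟩
    · refine ⟨0, t • erasedMonomial k a i, Submodule.smul_mem _ _ (Submodule.subset_span ⟨0, ?_⟩),
        ⟨?_, fun l hl _ => expAut_erasedDerivation_X_of_ne h₁ t hl⟩,
        expAut_erasedDerivation_X_self h₁ t⟩
      · change expFun ((0 : k) • erasedDerivation k b j) _ = _
        rw [expFun_eq_sum _ (N := 1) (by simp)]
        simp
      · rw [zero_smul, add_zero]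
        exact expAut_erasedDerivation_X_of_ne h₁ t hij.symm
    · have h := isTranslation_expAut hij h₂ t
      exact ⟨t, 0, zero_mem _, h.1, by rw [add_zero]; exact h.2⟩
  | one => exact ⟨0, 0, zero_mem _, ⟨by simp, fun _ _ _ => rfl⟩, by simp⟩
  | mul g h _ _ hg hh =>
    obtain ⟨s, v, hv, hgs, hgv⟩ := hg
    obtain ⟨t, w, hw, hht, hhw⟩ := hh
    refine ⟨s + t, v + g w, add_mem hv (hgs.apply_mem_translateSpan h₂ hij hb hw), hgs.mul hb hht, ?_⟩
    rw [AlgEquiv.mul_apply, hhw, map_add, hgv, add_assoc]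
  | inv g _ hg =>
    obtain ⟨s, v, hv, hgs, hgv⟩ := hg
    refine ⟨-s, -(g⁻¹ v), neg_mem ((hgs.inv hb).apply_mem_translateSpan h₂ hij hb hv), hgs.inv hb, ?_⟩
    apply g.injective
    rw [map_add, map_neg, hgv]
    change g (g.symm _) = _ + -g (g.symm v)
    rw [AlgEquiv.apply_symm_apply, AlgEquiv.apply_symm_apply]
    abel

/-- Conjugating `exp(c ∂₁)` by the flow `τ s` of the second derivation adds to `x_i` the
`c`-multiple of the translate at `s`. Products of such conjugates realize every `w` in the span, and
a final factor `τ t` supplies the translation. -/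
theorem exists_mem_groupGenerated_erasedDerivation (hij : i ≠ j) (hb : b i = 0) (t : k)
    {w : MvPolynomial σ k} (hw : w ∈ translateSpan a i h₂) :
    ∃ g ∈ groupGenerated (erasedDerivation k a i) (erasedDerivation k b j) h₁ h₂,
      IsTranslation b i j g.toAlgHom t ∧ g (MvPolynomial.X i) = MvPolynomial.X i + w := by
  set H := groupGenerated (erasedDerivation k a i) (erasedDerivation k b j) h₁ h₂
  let τ : k → (MvPolynomial σ k ≃ₐ[k] MvPolynomial σ k) := fun t =>
    expAut (t • erasedDerivation k b j) (h₂.smul t)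
  have hτ : ∀ t, τ t ∈ H := fun t => Subgroup.subset_closure (Or.inr ⟨t, rfl⟩)
  have hτt : ∀ t, IsTranslation b i j (τ t).toAlgHom t := fun t => (isTranslation_expAut hij h₂ t).1
  have hτi : ∀ t, τ t (MvPolynomial.X i) = MvPolynomial.X i := fun t =>
    (isTranslation_expAut hij h₂ t).2
  -- The scalar `c` is quantified inside so that span induction passes scalar multiples, which have
  -- no direct counterpart among group elements.
  have key : ∀ w ∈ translateSpan a i h₂, ∀ c : k, ∃ g ∈ H,
      IsTranslation b i j g.toAlgHom 0 ∧ g (MvPolynomial.X i) = MvPolynomial.X i + c • w := by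
    intro w hw
    induction hw using Submodule.span_induction with
    | mem w hw =>
      obtain ⟨s, rfl⟩ := hw
      intro c
      let g := expAut (c • erasedDerivation k a i) (h₁.smul c)
      have hg : IsTranslation b i j g.toAlgHom 0 := by
        refine ⟨?_, fun l hl _ => expAut_erasedDerivation_X_of_ne h₁ c hl⟩
        rw [zero_smul, add_zero]
        exact expAut_erasedDerivation_X_of_ne h₁ c hij.symm
      refine ⟨τ s * g * (τ s)⁻¹, mul_mem (mul_mem (hτ s) (Subgroup.subset_closure (Or.inl ⟨c, rfl⟩)))
        (inv_mem (hτ s)), ?_, ?_⟩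
      · have := ((hτt s).mul hb hg).mul hb ((hτt s).inv hb)
        rwa [add_zero, add_neg_cancel] at this
      · have h1 : (τ s)⁻¹ (MvPolynomial.X i) = MvPolynomial.X i := by
          apply (τ s).injective
          rw [hτi]
          exact (τ s).apply_symm_apply _
        have h2 : g (MvPolynomial.X i) = MvPolynomial.X i + c • erasedMonomial k a i :=
          expAut_erasedDerivation_X_self h₁ c
        rw [AlgEquiv.mul_apply, AlgEquiv.mul_apply, h1, h2, map_add, map_smul, hτi]
    | zero => exact fun c => ⟨1, one_mem _, ⟨by simp, fun _ _ _ => rfl⟩, by simp⟩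
    | add v w hv hw ih1 ih2 =>
      intro c
      obtain ⟨g, hg, hg0, hgv⟩ := ih1 c
      obtain ⟨h, hh, hh0, hhw⟩ := ih2 c
      refine ⟨g * h, mul_mem hg hh, by simpa using hg0.mul hb hh0, ?_⟩
      have h1 : g.toAlgHom w = w := apply_eq_self_of_mem_translateSpan h₂ hij hb (fun l hl => by
        by_cases hlj : l = j
        · rw [hlj, hg0.1, zero_smul, add_zero]
        · exact hg0.2 l hl hlj) hw
      rw [AlgEquiv.mul_apply, hhw, map_add, map_smul, hgv, smul_add, add_assoc]
      congr 3
    | smul d w _ ih =>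
      intro c
      rw [smul_smul]
      exact ih (c * d)
  -- Composing with `τ t` on the left applies it to the shift of `x_i`, so the shift to realize
  -- first is `(τ t)⁻¹ w`.
  obtain ⟨g, hg, hg0, hgw⟩ := key _ (((hτt t).inv hb).apply_mem_translateSpan h₂ hij hb hw) 1
  refine ⟨τ t * g, mul_mem (hτ t) hg, by simpa using (hτt t).mul hb hg0, ?_⟩
  rw [AlgEquiv.mul_apply, hgw, map_add, hτi, one_smul]
  congr 1
  exact (τ t).apply_symm_apply w

end ErasedDerivations

/-! ### Unipotence and faithfulness of the triangular group -/

section ErasedGroup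

variable {k : Type*} [Field k] [CharZero k] {σ : Type*} [Fintype σ] [DecidableEq σ]
  {a b : σ → ℕ} {i j : σ} (h₁ : IsLocallyNilpotent (erasedDerivation k a i))
  (h₂ : IsLocallyNilpotent (erasedDerivation k b j))

/-- Triangularity: the other variables are fixed, `x_j` moves by a fixed monomial, and `x_i` moves
by a polynomial in the variables already treated. -/
theorem locallyUnipotentSubalgebra_eq_top (hij : i ≠ j) (hb : b i = 0)
    {g : MvPolynomial σ k →ₐ[k] MvPolynomial σ k} {t : k} (hg : IsTranslation b i j g t)
    {w : MvPolynomial σ k} (hw : w ∈ translateSpan a i h₂)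
    (hgw : g (MvPolynomial.X i) = MvPolynomial.X i + w) : locallyUnipotentSubalgebra g = ⊤ := by
  set S := locallyUnipotentSubalgebra g
  have hM : erasedMonomial k b j ∈ S :=
    mem_locallyUnipotentSubalgebra_of_fixed (algHom_erasedMonomial_of_fixed hb hg.2)
  have hX : ∀ l, l ≠ i → MvPolynomial.X l ∈ S := by
    intro l hl
    by_cases hlj : l = j
    · rw [hlj]
      refine mem_locallyUnipotentSubalgebra_of_sub_mem ?_
      rw [hg.1, add_sub_cancel_left]
      exact S.smul_mem hM t
    · exact mem_locallyUnipotentSubalgebra_of_fixed (hg.2 l hl hlj)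
  have hW : translateSpan a i h₂ ≤ Subalgebra.toSubmodule S := by
    refine Submodule.span_le.mpr ?_
    rintro _ ⟨s, rfl⟩
    simp only [erasedMonomial, map_prod, map_pow]
    refine S.prod_mem fun l hl => S.pow_mem ?_ _
    have hl' := Finset.ne_of_mem_erase hl
    by_cases hlj : l = j
    · rw [hlj, expAut_erasedDerivation_X_self h₂ s]
      exact S.add_mem (hX j hij.symm) (S.smul_mem hM s)
    · rw [expAut_erasedDerivation_X_of_ne h₂ s hlj]
      exact hX l hl'
  rw [eq_top_iff, ← MvPolynomial.adjoin_range_X, Algebra.adjoin_le_iff]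
  rintro _ ⟨l, rfl⟩
  by_cases hl : l = i
  · rw [hl]
    refine mem_locallyUnipotentSubalgebra_of_sub_mem ?_
    rw [hgw, add_sub_cancel_left]
    exact hW hw
  · exact hX l hl

/-- If `x_i` does not occur in the coefficient of `∂/∂x_j`, then the two root subgroups generate a
unipotent algebraic group. -/
theorem isUnipotentAlgebraicGroup_erasedDerivation (hij : i ≠ j) (hb : b i = 0) :
    IsUnipotentAlgebraicGroup
      (groupGenerated (erasedDerivation k a i) (erasedDerivation k b j) h₁ h₂) := by
  set W := translateSpan a i h₂
  have hfin : FiniteDimensional k W := finiteDimensional_translateSpan h₂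
  let β := Module.finBasis k W
  -- The parameter space is `k × W`: `none` holds the translation of `x_j`, and `some s` the
  -- coordinates of the shift of `x_i`.
  let w : (Option (Fin (Module.finrank k W)) → k) → W := fun t => ∑ s, t (some s) • β s
  choose F hFG hFt hFw using fun t : Option (Fin (Module.finrank k W)) → k =>
    exists_mem_groupGenerated_erasedDerivation h₂ h₁ hij hb (t none) (w t).2
  obtain ⟨φ, hφ⟩ := Module.Projective.exists_dual_eq_one k (erasedMonomial_ne_zero (k := k) b j)
  choose ν hν using fun s => LinearMap.exists_extend (β.coord s)
  refine isUnipotentAlgebraicGroup_of_parametrization _ F ?_ ?_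
    (fun o => o.elim (MvPolynomial.X j) fun _ => MvPolynomial.X i)
    (fun o => o.elim φ ν) ?_ ?_
  · refine Set.Subset.antisymm (Set.range_subset_iff.mpr hFG) fun g hg => ?_
    obtain ⟨t, v, hv, hgt, hgv⟩ := exists_of_mem_groupGenerated_erasedDerivation h₂ h₁ hij hb hg
    refine ⟨fun o => o.elim t (β.repr ⟨v, hv⟩), ?_⟩
    refine algEquiv_eq_of_isTranslation (hFt _) hgt ?_
    rw [hFw, hgv]
    congr 1
    exact congrArg Subtype.val (β.sum_repr ⟨v, hv⟩)
  · refine exists_eval_smul_of_forall_X (fun t => (F t).toAlgHom) fun l => ?_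
    by_cases hli : l = i
    · refine ⟨MvPolynomial.C (MvPolynomial.X i) +
        ∑ s, MvPolynomial.X (some s) * MvPolynomial.C (β s : MvPolynomial σ k), fun t => ?_⟩
      subst hli
      change F t _ = _
      rw [hFw, map_add, MvPolynomial.aeval_C, map_sum, Submodule.coe_sum]
      congr 1
      refine Finset.sum_congr rfl fun s _ => ?_
      rw [map_mul, MvPolynomial.aeval_X, MvPolynomial.aeval_C, ← MvPolynomial.smul_eq_C_mul]
      rfl
    by_cases hlj : l = j
    · refine ⟨MvPolynomial.C (MvPolynomial.X j) +
        MvPolynomial.X none * MvPolynomial.C (erasedMonomial k b j), fun t => ?_⟩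
      rw [hlj, (hFt t).1, map_add, map_mul, MvPolynomial.aeval_X, MvPolynomial.aeval_C,
        MvPolynomial.aeval_C, MvPolynomial.smul_eq_C_mul]
      rfl
    · exact ⟨MvPolynomial.C (MvPolynomial.X l), fun t => by
        rw [(hFt t).2 l hli hlj, MvPolynomial.aeval_C]; rfl⟩
  · intro t o
    rcases o with _ | s
    · have : F t (MvPolynomial.X j) = _ := (hFt t).1
      simp only [Option.elim]
      rw [this, add_sub_cancel_left, map_smul, hφ, smul_eq_mul, mul_one]
    · simp only [Option.elim]
      rw [hFw, add_sub_cancel_left]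
      have h1 : ν s (w t : MvPolynomial σ k) = β.coord s (w t) := LinearMap.congr_fun (hν s) (w t)
      rw [h1, Module.Basis.coord_apply, Module.Basis.repr_sum_self]
  · intro g hg f
    obtain ⟨t, v, hv, hgt, hgv⟩ := exists_of_mem_groupGenerated_erasedDerivation h₂ h₁ hij hb hg
    have := locallyUnipotentSubalgebra_eq_top h₂ hij hb hgt hv hgv
    have hf : f ∈ locallyUnipotentSubalgebra g.toAlgHom := this ▸ Algebra.mem_top
    exact hf

/-- An element of the group fixing a monomial in which both `x_i` and `x_j` occur is trivial. -/
theorem eq_one_of_apply_monomial_eq (hij : i ≠ j) (hb : b i = 0)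
    {g : MvPolynomial σ k ≃ₐ[k] MvPolynomial σ k}
    (hg : g ∈ groupGenerated (erasedDerivation k a i) (erasedDerivation k b j) h₁ h₂)
    {m : σ → ℕ} (hmi : m i ≠ 0) (hmj : m j ≠ 0)
    (hm : g (∏ l, MvPolynomial.X l ^ m l) = ∏ l, MvPolynomial.X l ^ m l) : g = 1 := by
  obtain ⟨t, w, hw, hgt, hgw⟩ := exists_of_mem_groupGenerated_erasedDerivation h₂ h₁ hij hb hg
  -- If substituting `v` for `x_s` annihilates `g(x_s)`, it annihilates the `g`-image of the
  -- monomial, hence the fixed monomial itself. That becomes a product of powers of `v` and of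
  -- nonzero variables, so `v = 0`. It is used with `v` the negative of each shift.
  have hkill : ∀ (s : σ) (_ : m s ≠ 0) (v : MvPolynomial σ k)
      (_ : MvPolynomial.aeval (Function.update MvPolynomial.X s v) (g (MvPolynomial.X s)) =
        (0 : MvPolynomial σ k)), v = 0 := by
    intro s hs v hv
    have h1 := congrArg (MvPolynomial.aeval (Function.update MvPolynomial.X s v)) hm
    rw [map_prod, map_prod, Finset.prod_eq_zero (Finset.mem_univ s), map_prod, eq_comm,
      Finset.prod_eq_zero_iff] at h1
    · obtain ⟨l, -, hl⟩ := h1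
      rw [map_pow, MvPolynomial.aeval_X] at hl
      have hl' := eq_zero_of_pow_eq_zero hl
      by_cases hls : l = s
      · rwa [hls, Function.update_self] at hl'
      · rw [Function.update_of_ne hls] at hl'
        exact absurd hl' (MvPolynomial.X_ne_zero l)
    · rw [map_pow, map_pow, hv, zero_pow hs]
  have ht : t = 0 := by
    have h0 := hkill j hmj (-(t • erasedMonomial k b j)) (by
      have h1 : g (MvPolynomial.X j) = _ := hgt.1
      rw [h1, map_add, map_smul, MvPolynomial.aeval_X, Function.update_self,
        algHom_erasedMonomial_of_fixed (i := i) hb fun l _ hlj => by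
          rw [MvPolynomial.aeval_X, Function.update_of_ne hlj]]
      exact neg_add_cancel _)
    exact (smul_eq_zero.mp (neg_eq_zero.mp h0)).resolve_right (erasedMonomial_ne_zero b j)
  have hw0 : w = 0 := by
    have h0 := hkill i hmi (-w) (by
      rw [hgw, map_add, MvPolynomial.aeval_X, Function.update_self,
        apply_eq_self_of_mem_translateSpan h₂ hij hb (fun l hl => by
          rw [MvPolynomial.aeval_X, Function.update_of_ne hl]) hw]
      exact neg_add_cancel _)
    exact neg_eq_zero.mp h0
  refine algEquiv_eq_of_isTranslation (b := b) (i := i) (j := j) (t := 0) (ht ▸ hgt)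
    ⟨by simp, fun _ _ _ => rfl⟩ ?_
  rw [hgw, hw0, add_zero]
  rfl

end ErasedGroup

/-! ### Restricting automorphism groups to a subalgebra -/

section Restriction

variable {k : Type*} [Field k] {A B : Type*} [CommRing A] [Algebra k A] [CommRing B] [Algebra k B]

/-- A unipotent algebraic group of automorphisms of `B` that restricts to a subalgebra `A`, with
trivial kernel, gives a unipotent algebraic group of automorphisms of `A`. -/
theorem IsUnipotentAlgebraicGroup.restrict {ι : A →ₐ[k] B} (hι : Function.Injective ι)
    {G : Subgroup (B ≃ₐ[k] B)} (hG : IsUnipotentAlgebraicGroup G) {H : Subgroup (A ≃ₐ[k] A)}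
    (hGH : ∀ g ∈ G, ∃ h ∈ H, ∀ a, ι (h a) = g (ι a))
    (hHG : ∀ h ∈ H, ∃ g ∈ G, ∀ a, ι (h a) = g (ι a))
    (hker : ∀ g ∈ G, (∀ a, g (ι a) = ι a) → g = 1) : IsUnipotentAlgebraicGroup H := by
  obtain ⟨m, U, φ, hU, hreg, hinj, hrange⟩ := hG
  have hφ : ∀ u, φ u ∈ G := fun u => hrange ▸ ⟨u, rfl⟩
  choose r hrH hr using fun u => hGH (φ u) (hφ u)
  let φ' : U →* (A ≃ₐ[k] A) :=
    { toFun := r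
      map_one' := by
        ext a
        apply hι
        rw [hr, map_one]
        rfl
      map_mul' := fun u v => by
        ext a
        apply hι
        rw [hr, map_mul, AlgEquiv.mul_apply, AlgEquiv.mul_apply, hr, hr] }
  refine ⟨m, U, φ', hU, ?_, ?_, ?_⟩
  · intro f
    obtain ⟨q, P, c, hP⟩ := hreg (ι f)
    -- The coefficients `c l` lie in `B` and need not come from `A`; a linear retraction moves them
    -- there.
    obtain ⟨π, hπ⟩ := ι.toLinearMap.exists_leftInverse_of_injective (LinearMap.ker_eq_bot.mpr hι)
    refine ⟨q, P, fun l => π (c l), fun u => ?_⟩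
    have h1 : φ' u f = π (ι (r u f)) := (LinearMap.congr_fun hπ (r u f)).symm
    rw [h1, hr, hP, map_sum]
    simp only [map_smul]
  · refine (injective_iff_map_eq_one φ').mpr fun u hu => ?_
    apply hinj
    rw [map_one]
    refine hker _ (hφ u) fun a => ?_
    have hu' : r u = 1 := hu
    rw [← hr, hu']
    rfl
  · ext h
    constructor
    · rintro ⟨u, rfl⟩
      exact hrH u
    · intro hh
      obtain ⟨g, hg, hgh⟩ := hHG h hh
      obtain ⟨u, rfl⟩ : g ∈ φ.range := hrange ▸ hg
      refine ⟨u, ?_⟩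
      ext a
      apply hι
      rw [hgh]
      exact hr u a

/-- If a subgroup of `P × Q` relates every element of `S` to an element of `T`, then it relates
every element of `⟨S⟩` to an element of `⟨T⟩`. -/
theorem exists_mem_closure_of_forall_exists_mem {P Q : Type*} [Group P] [Group Q]
    (K : Subgroup (P × Q)) {S : Set P} {T : Set Q} (hST : ∀ h ∈ S, ∃ g ∈ T, (h, g) ∈ K) {h : P}
    (hh : h ∈ Subgroup.closure S) : ∃ g ∈ Subgroup.closure T, (h, g) ∈ K := by
  induction hh using Subgroup.closure_induction with
  | mem h hh =>
    obtain ⟨g, hg, hgh⟩ := hST h hh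
    exact ⟨g, Subgroup.subset_closure hg, hgh⟩
  | one => exact ⟨1, one_mem _, one_mem _⟩
  | mul x y _ _ hx hy =>
    obtain ⟨g, hg, hgx⟩ := hx
    obtain ⟨g', hg', hgy⟩ := hy
    exact ⟨g * g', mul_mem hg hg', mul_mem hgx hgy⟩
  | inv x _ hx =>
    obtain ⟨g, hg, hgx⟩ := hx
    exact ⟨g⁻¹, inv_mem hg, inv_mem hgx⟩

/-- The pairs of automorphisms of `A` and `B` intertwined by `ι`. -/
def intertwinedSubgroup (ι : A →ₐ[k] B) : Subgroup ((A ≃ₐ[k] A) × (B ≃ₐ[k] B)) where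
  carrier := {p | ∀ a, ι (p.1 a) = p.2 (ι a)}
  one_mem' _ := rfl
  mul_mem' {p q} hp hq a := by
    change ι (p.1 (q.1 a)) = p.2 (q.2 (ι a))
    rw [hp, hq]
  inv_mem' {p} hp a := by
    apply p.2.injective
    change p.2 (ι (p.1.symm a)) = p.2 (p.2.symm (ι a))
    rw [← hp, AlgEquiv.apply_symm_apply, AlgEquiv.apply_symm_apply]

variable [CharZero k]

theorem algHom_expAut_of_semiconj {ι : A →ₐ[k] B} {D : Derivation k A A} {D' : Derivation k B B}
    (h : ∀ a, ι (D a) = D' (ι a)) (hD : IsLocallyNilpotent D) (hD' : IsLocallyNilpotent D') (t : k)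
    (a : A) : ι (expAut (t • D) (hD.smul t) a) = expAut (t • D') (hD'.smul t) (ι a) := by
  obtain ⟨N, hN⟩ := hD a
  have hsemi : ∀ n, ι (D^[n] a) = D'^[n] (ι a) := fun n =>
    Function.Semiconj.iterate_right (f := ι) (ga := D) (gb := D') h n a
  change ι (expFun (t • D) a) = expFun (t • D') (ι a)
  rw [expFun_eq_sum (t • D) (N := N) (by rw [smul_iterate, hN, smul_zero]),
    expFun_eq_sum (t • D') (N := N) (by rw [smul_iterate, ← hsemi, hN, map_zero, smul_zero]), map_sum]
  refine Finset.sum_congr rfl fun n _ => ?_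
  rw [map_smul, smul_iterate, smul_iterate, map_smul, hsemi]

/-- If a pair of derivations of `A` extends to `B`, so do the groups they generate. -/
theorem IsUnipotentAlgebraicGroup.groupGenerated_of_semiconj {ι : A →ₐ[k] B}
    (hι : Function.Injective ι) {D₁ D₂ : Derivation k A A} {E₁ E₂ : Derivation k B B}
    (h₁ : ∀ a, ι (D₁ a) = E₁ (ι a)) (h₂ : ∀ a, ι (D₂ a) = E₂ (ι a)) (hD₁ : IsLocallyNilpotent D₁)
    (hD₂ : IsLocallyNilpotent D₂) (hE₁ : IsLocallyNilpotent E₁) (hE₂ : IsLocallyNilpotent E₂)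
    (hG : IsUnipotentAlgebraicGroup (groupGenerated E₁ E₂ hE₁ hE₂))
    (hker : ∀ g ∈ groupGenerated E₁ E₂ hE₁ hE₂, (∀ a, g (ι a) = ι a) → g = 1) :
    IsUnipotentAlgebraicGroup (groupGenerated D₁ D₂ hD₁ hD₂) := by
  -- The intertwining relation on generators propagates to the generated groups in both directions;
  -- swapping the factors gives the second direction.
  refine hG.restrict hι
    (fun g hg => exists_mem_closure_of_forall_exists_mem
      ((intertwinedSubgroup ι).comap MulEquiv.prodComm.toMonoidHom) ?_ hg)
    (fun h hh => exists_mem_closure_of_forall_exists_mem (intertwinedSubgroup ι) ?_ hh) hker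
  · rintro _ (⟨t, rfl⟩ | ⟨t, rfl⟩)
    · exact ⟨_, Or.inl ⟨t, rfl⟩, algHom_expAut_of_semiconj h₁ hD₁ hE₁ t⟩
    · exact ⟨_, Or.inr ⟨t, rfl⟩, algHom_expAut_of_semiconj h₂ hD₂ hE₂ t⟩
  · rintro _ (⟨t, rfl⟩ | ⟨t, rfl⟩)
    · exact ⟨_, Or.inl ⟨t, rfl⟩, algHom_expAut_of_semiconj h₁ hD₁ hE₁ t⟩
    · exact ⟨_, Or.inr ⟨t, rfl⟩, algHom_expAut_of_semiconj h₂ hD₂ hE₂ t⟩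

/-- A unipotent algebraic group is nilpotent as an abstract group. -/
theorem IsUnipotentAlgebraicGroup.isNilpotent {G : Subgroup (A ≃ₐ[k] A)}
    (hG : IsUnipotentAlgebraicGroup G) : Group.IsNilpotent G := by
  obtain ⟨m, U, φ, hU, -, hinj, rfl⟩ := hG
  have := isNilpotent_of_forall_isNilpotent_sub_one U hU.2
  exact Group.nilpotent_of_surjective φ.rangeRestrict φ.rangeRestrict_surjective

theorem groupGenerated_comm (D₁ D₂ : Derivation k A A) (h₁ : IsLocallyNilpotent D₁)
    (h₂ : IsLocallyNilpotent D₂) : groupGenerated D₁ D₂ h₁ h₂ = groupGenerated D₂ D₁ h₂ h₁ := by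
  rw [groupGenerated, groupGenerated, Set.union_comm]

end Restriction

/-! ### The bracket obstruction in a nilpotent Lie algebra -/

section LieGenerated

variable {k : Type*} [Field k] {A : Type*} [CommRing A] [Algebra k A]

theorem lieGenerated_comm (D₁ D₂ : Derivation k A A) : lieGenerated D₁ D₂ = lieGenerated D₂ D₁ := by
  rw [lieGenerated, lieGenerated, Set.pair_comm]

/-- In a finite-dimensional nilpotent Lie algebra the bracket of the generators is ad-nilpotent. -/
theorem exists_ad_bracket_pow_eq_zero_of_isNilpotent (D₁ D₂ : Derivation k A A)
    (h : FiniteDimensional k (lieGenerated D₁ D₂) ∧ LieRing.IsNilpotent (lieGenerated D₁ D₂)) :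
    ∃ N : ℕ, ((LieAlgebra.ad k (Derivation k A A) ⁅D₁, D₂⁆) ^ N) D₁ = 0 := by
  obtain ⟨hfin, hnil⟩ := h
  have hm₁ : D₁ ∈ lieGenerated D₁ D₂ := LieSubalgebra.subset_lieSpan (Or.inl rfl)
  have hm₂ : D₂ ∈ lieGenerated D₁ D₂ := LieSubalgebra.subset_lieSpan (Or.inr rfl)
  let x : lieGenerated D₁ D₂ := ⟨D₁, hm₁⟩
  let y : lieGenerated D₁ D₂ := ⟨D₂, hm₂⟩
  obtain ⟨N, hN⟩ := (LieAlgebra.isNilpotent_iff_forall (R := k)).mp hnil ⁅x, y⁆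
  refine ⟨N, ?_⟩
  have key : ∀ n, (((LieAlgebra.ad k _ ⁅x, y⁆) ^ n) x : Derivation k A A) =
      ((LieAlgebra.ad k (Derivation k A A) ⁅D₁, D₂⁆) ^ n) D₁ := by
    intro n
    induction n with
    | zero => rfl
    | succ n ih =>
      rw [pow_succ', pow_succ', Module.End.mul_apply, Module.End.mul_apply, LieAlgebra.ad_apply,
        LieAlgebra.ad_apply, LieSubalgebra.coe_bracket, ih]
      rfl
  rw [← key, hN]
  rfl

end LieGenerated

/-! ### Gordan's theorem -/

section Gordan

/-- Gordan's theorem: finitely many vectors without a nontrivial relation with nonnegative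
coefficients lie in an open half-space. -/
theorem exists_dual_pos_of_forall_nonneg_relation {K : Type*} [Field K] [LinearOrder K]
    [IsStrictOrderedRing K] [Archimedean K] {V : Type*} [AddCommGroup V] [Module K V] :
    ∀ (n : ℕ) (v : Fin n → V),
      (∀ c : Fin n → K, (∀ i, 0 ≤ c i) → ∑ i, c i • v i = 0 → c = 0) →
        ∃ f : Module.Dual K V, ∀ i, 0 < f (v i) := by
  intro n
  induction n with
  | zero => exact fun v _ => ⟨0, fun i => i.elim0⟩
  | succ n ih =>
    intro v hv
    obtain ⟨f, hf⟩ := ih (fun i => v i.succ) fun c hc h => by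
      have := hv (Fin.cons 0 c) (Fin.cases le_rfl hc) (by simpa [Fin.sum_univ_succ] using h)
      funext i
      simpa using congrFun this i.succ
    rcases lt_or_ge 0 (f (v 0)) with h0 | h0
    · exact ⟨f, Fin.cases h0 hf⟩
    -- These vectors lie in the kernel of `f`. As `f (v 0) ≤ 0` they are nonnegative combinations of
    -- the `v i`, so a relation among them yields one among the `v i`.
    obtain ⟨g, hg⟩ := ih (fun i => f (v i.succ) • v 0 - f (v 0) • v i.succ) fun c hc h => by
      have h1 := hv (Fin.cons (∑ i, c i * f (v i.succ)) fun i => c i * -f (v 0))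
        (Fin.cases (by simpa using Finset.sum_nonneg fun i _ => mul_nonneg (hc i) (hf i).le)
          fun i => mul_nonneg (hc i) (neg_nonneg.mpr h0)) (by
        rw [← h, Fin.sum_univ_succ]
        simp only [Fin.cons_zero, Fin.cons_succ, smul_sub, smul_smul, Finset.sum_sub_distrib,
          Finset.sum_smul, mul_neg, neg_smul, Finset.sum_neg_distrib]
        abel)
      have h2 : ∑ i, c i * f (v i.succ) = 0 := by simpa using congrFun h1 0
      funext i
      have h3 := (Finset.sum_eq_zero_iff_of_nonneg
        fun i _ => mul_nonneg (hc i) (hf i).le).mp h2 i (Finset.mem_univ i)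
      exact (mul_eq_zero.mp h3).resolve_right (hf i).ne'
    have hv0 : v 0 ≠ 0 := fun h => by
      have h1 := hv (Fin.cons 1 0) (Fin.cases (by simp) (by simp)) (by simp [Fin.sum_univ_succ, h])
      simpa using congrFun h1 0
    obtain ⟨u, hu⟩ := Module.Projective.exists_dual_eq_one K hv0
    -- The functional `g (v 0) • f - f (v 0) • g` vanishes at `v 0` and is positive at the other
    -- vectors; a large multiple of it absorbs the values of `u`, while `u (v 0) = 1` handles `v 0`.
    have hpos : ∀ i : Fin n, 0 < g (v 0) * f (v i.succ) - f (v 0) * g (v i.succ) := fun i => by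
      have := hg i
      simp only [map_sub, map_smul, smul_eq_mul] at this
      linarith
    choose N hN using fun i : Fin n =>
      exists_nat_gt (-u (v i.succ) / (g (v 0) * f (v i.succ) - f (v 0) * g (v i.succ)))
    refine ⟨((∑ i, N i : ℕ) : K) • (g (v 0) • f - f (v 0) • g) + u, Fin.cases ?_ fun i => ?_⟩
    · simp [hu, mul_comm]
    · have h1 : (N i : K) ≤ ((∑ i, N i : ℕ) : K) := by
        exact_mod_cast Finset.single_le_sum (f := N) (fun _ _ => Nat.zero_le _) (Finset.mem_univ i)
      have h2 := (div_lt_iff₀ (hpos i)).mp ((hN i).trans_le h1)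
      simp only [LinearMap.add_apply, LinearMap.smul_apply, LinearMap.sub_apply, smul_eq_mul]
      linarith

end Gordan

/-! ### The three equivalent conditions for monomial derivations -/

section Equivalence

variable {k : Type*} [Field k] [CharZero k] {G : Type*} [AddCommGroup G] {A : Type*} [CommRing A]
  [Algebra k A] {ι : A →ₗ[k] AddMonoidAlgebra k G} {D₁ D₂ : Derivation k A A} {e₁ e₂ : G}
  {ρ₁ ρ₂ : G →+ ℤ}

/-- The obstruction needs the inequality between the two pairings in a given direction, so both
orders of the derivations are assumed ad-nilpotent. -/
theorem min_eq_zero_of_actsAsMonomial (h₁ : ActsAsMonomial ι D₁ e₁ ρ₁)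
    (h₂ : ActsAsMonomial ι D₂ e₂ ρ₂) (h11 : ρ₁ e₁ = -1) (h22 : ρ₂ e₂ = -1) (h12 : 0 ≤ ρ₁ e₂)
    (h21 : 0 ≤ ρ₂ e₁) {m : G} (hm : AddMonoidAlgebra.single m (1 : k) ∈ LinearMap.range ι)
    (hm₁ : 0 < ρ₁ m) (hm₂ : 0 < ρ₂ m)
    (hN₁ : ∃ N : ℕ, ((LieAlgebra.ad k (Derivation k A A) ⁅D₁, D₂⁆) ^ N) D₁ = 0)
    (hN₂ : ∃ N : ℕ, ((LieAlgebra.ad k (Derivation k A A) ⁅D₂, D₁⁆) ^ N) D₂ = 0) :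
    min (ρ₁ e₂) (ρ₂ e₁) = 0 := by
  by_contra hne
  have hpos : 0 < min (ρ₁ e₂) (ρ₂ e₁) := lt_of_le_of_ne (le_min h12 h21) (Ne.symm hne)
  obtain ⟨hd, hc⟩ := lt_min_iff.mp hpos
  rcases le_total (ρ₁ e₂) (ρ₂ e₁) with h | h
  · obtain ⟨N, hN⟩ := hN₁
    exact ad_bracket_pow_ne_zero h₁ h₂ h11 h22 hd h hm hm₁ hm₂ N hN
  · obtain ⟨N, hN⟩ := hN₂
    exact ad_bracket_pow_ne_zero h₂ h₁ h22 h11 hc h hm hm₂ hm₁ N hN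

/-- Unipotence when one pairing vanishes enters as a hypothesis: it comes from the triangular group
of the Cox ring, not from the bracket calculus. -/
theorem tfae_of_actsAsMonomial (hι : Function.Injective ι) (h₁ : ActsAsMonomial ι D₁ e₁ ρ₁)
    (h₂ : ActsAsMonomial ι D₂ e₂ ρ₂) (h11 : ρ₁ e₁ = -1) (h22 : ρ₂ e₂ = -1) (h12 : 0 ≤ ρ₁ e₂)
    (h21 : 0 ≤ ρ₂ e₁) {m : G} (hm : AddMonoidAlgebra.single m (1 : k) ∈ LinearMap.range ι)
    (hm₁ : 0 < ρ₁ m) (hm₂ : 0 < ρ₂ m) (hD₁ : IsLocallyNilpotent D₁) (hD₂ : IsLocallyNilpotent D₂)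
    (hunip₁ : ρ₁ e₂ = 0 → IsUnipotentAlgebraicGroup (groupGenerated D₁ D₂ hD₁ hD₂))
    (hunip₂ : ρ₂ e₁ = 0 → IsUnipotentAlgebraicGroup (groupGenerated D₂ D₁ hD₂ hD₁)) :
    List.TFAE [IsUnipotentAlgebraicGroup (groupGenerated D₁ D₂ hD₁ hD₂),
      FiniteDimensional k (lieGenerated D₁ D₂) ∧ LieRing.IsNilpotent (lieGenerated D₁ D₂),
      min (ρ₁ e₂) (ρ₂ e₁) = 0] := by
  have hmin : min (ρ₁ e₂) (ρ₂ e₁) = 0 → ρ₁ e₂ = 0 ∨ ρ₂ e₁ = 0 := fun h => by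
    rcases min_choice (ρ₁ e₂) (ρ₂ e₁) with h' | h'
    · exact Or.inl (h'.symm.trans h)
    · exact Or.inr (h'.symm.trans h)
  tfae_have 1 → 3 := fun h => by
    have hnil := h.isNilpotent
    refine min_eq_zero_of_actsAsMonomial h₁ h₂ h11 h22 h12 h21 hm hm₁ hm₂
      (exists_ad_bracket_pow_eq_zero D₁ D₂ hD₁ hD₂ hnil)
      (exists_ad_bracket_pow_eq_zero D₂ D₁ hD₂ hD₁ ?_)
    rwa [groupGenerated_comm]
  tfae_have 2 → 3 := fun h => by
    refine min_eq_zero_of_actsAsMonomial h₁ h₂ h11 h22 h12 h21 hm hm₁ hm₂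
      (exists_ad_bracket_pow_eq_zero_of_isNilpotent D₁ D₂ h)
      (exists_ad_bracket_pow_eq_zero_of_isNilpotent D₂ D₁ ?_)
    rwa [lieGenerated_comm]
  tfae_have 3 → 1 := fun h => by
    rcases hmin h with h | h
    · exact hunip₁ h
    · rw [groupGenerated_comm]
      exact hunip₂ h
  tfae_have 3 → 2 := fun h => by
    rcases hmin h with h | h
    · exact finiteDimensional_and_isNilpotent_lieGenerated hι h₁ h₂ h11 h22 h h21
    · rw [lieGenerated_comm]
      exact finiteDimensional_and_isNilpotent_lieGenerated hι h₂ h₁ h22 h11 h h12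
  tfae_finish

end Equivalence

/-! ### Polynomial rings inside Laurent polynomials -/

section PolynomialRing

variable {k : Type*} [Field k] {σ : Type*}

/-- The embedding of the polynomial ring into the Laurent polynomials. -/
noncomputable def toLaurent (k : Type*) [Field k] (σ : Type*) :
    MvPolynomial σ k →ₗ[k] AddMonoidAlgebra k (σ → ℤ) :=
  AddMonoidAlgebra.mapDomainLinearMap k k fun s : σ →₀ ℕ => fun l => (s l : ℤ)

theorem toLaurent_monomial (s : σ →₀ ℕ) (c : k) :
    toLaurent k σ (MvPolynomial.monomial s c) = AddMonoidAlgebra.single (fun l => (s l : ℤ)) c :=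
  AddMonoidAlgebra.mapDomainLinearMap_single _ _ _

theorem toLaurent_injective : Function.Injective (toLaurent k σ) :=
  AddMonoidAlgebra.mapDomain_injective fun s t h => Finsupp.ext fun l => by
    exact_mod_cast congrFun h l

variable [Fintype σ] [DecidableEq σ]

theorem erasedMonomial_eq_monomial (a : σ → ℕ) (i : σ) :
    erasedMonomial k a i =
      MvPolynomial.monomial (Finsupp.equivFunOnFinite.symm (Function.update a i 0)) 1 := by
  rw [MvPolynomial.monomial_eq, Finsupp.prod_fintype _ _ fun _ => pow_zero _, map_one, one_mul,
    erasedMonomial, ← Finset.mul_prod_erase Finset.univ _ (Finset.mem_univ i)]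
  simp only [Finsupp.coe_equivFunOnFinite_symm, Function.update_self, pow_zero, one_mul]
  exact Finset.prod_congr rfl fun l hl => by
    rw [Function.update_of_ne (Finset.ne_of_mem_erase hl)]

theorem erasedDerivation_monomial (a : σ → ℕ) (i : σ) (s : σ →₀ ℕ) (c : k) :
    erasedDerivation k a i (MvPolynomial.monomial s c) =
      MvPolynomial.monomial (Finsupp.equivFunOnFinite.symm (Function.update a i 0) +
        (s - Finsupp.single i 1)) (c * s i) := by
  rw [erasedDerivation, Derivation.smul_apply, MvPolynomial.pderiv_monomial,
    erasedMonomial_eq_monomial, smul_eq_mul, MvPolynomial.monomial_mul, one_mul]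

theorem actsAsMonomial_erasedDerivation (a : σ → ℕ) (i : σ) :
    ActsAsMonomial (toLaurent k σ) (erasedDerivation k a i)
      (Function.update (fun l => (a l : ℤ)) i (-1)) (Pi.evalAddMonoidHom (fun _ : σ => ℤ) i) := by
  intro f
  induction f using AddMonoidAlgebra.induction_linear with
  | zero => simp only [map_zero]
  | add f g hf hg => simp only [map_add, hf, hg]
  | single s c =>
    change toLaurent k σ (erasedDerivation k a i (MvPolynomial.monomial s c)) =
      monomialOperator k _ _ (toLaurent k σ (MvPolynomial.monomial s c))
    rw [erasedDerivation_monomial, toLaurent_monomial, toLaurent_monomial, monomialOperator_single]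
    -- When `s i = 0` the truncated exponent `s - single i 1` is wrong, but its coefficient is zero.
    by_cases hs : s i = 0
    · simp [hs]
    · rw [Pi.evalAddMonoidHom_apply, Int.cast_natCast]
      congr 1
      funext l
      by_cases hl : l = i
      · subst hl
        simp only [Finsupp.coe_add, Pi.add_apply, Finsupp.coe_equivFunOnFinite_symm,
          Function.update_self, Finsupp.coe_tsub, Pi.sub_apply, Finsupp.single_eq_same]
        omega
      · simp only [Finsupp.coe_add, Pi.add_apply, Finsupp.coe_equivFunOnFinite_symm,
          Function.update_of_ne hl, Finsupp.coe_tsub, Pi.sub_apply, Finsupp.single_eq_of_ne hl]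
        omega

end PolynomialRing

/-! ### Toric varieties and the embedding into the Cox ring -/

namespace ToricCone

open Matrix

variable {n : ℕ} (X : ToricCone n)

theorem exists_forall_ray_dotProduct_pos : ∃ m : Fin n → ℤ, ∀ j, 0 < X.ray j ⬝ᵥ m := by
  have hmem : ∀ j, (fun i => (X.ray j i : ℚ)) ∈ X.cone := fun j =>
    (X.isRayGenerator_ray j).1.le (Submodule.subset_span rfl)
  have hne : ∀ j, (fun i => (X.ray j i : ℚ)) ≠ 0 := fun j h => by
    have := (X.isRayGenerator_ray j).2 0 fun i => by
      have := congrFun h i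
      simp only [Pi.zero_apply, Int.cast_eq_zero] at this
      rw [this]
    exact not_isUnit_zero this
  obtain ⟨f, hf⟩ := exists_dual_pos_of_forall_nonneg_relation (K := ℚ) _
    (fun j i => (X.ray j i : ℚ)) fun c hc h => by
      by_contra hc0
      obtain ⟨j, hj⟩ := Function.ne_iff.mp hc0
      have hcj : c j ≠ 0 := hj
      rw [← Finset.add_sum_erase _ _ (Finset.mem_univ j)] at h
      refine X.salient (c j • fun i => (X.ray j i : ℚ)) (PointedCone.smul_mem _ (hc j) (hmem j))
        (smul_ne_zero hcj (hne j)) ?_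
      rw [neg_eq_of_add_eq_zero_right h]
      exact Submodule.sum_mem _ fun l _ => PointedCone.smul_mem _ (hc l) (hmem l)
  obtain ⟨b, hb⟩ := IsLocalization.exist_integer_multiples_of_finite (nonZeroDivisors ℤ)
    fun i : Fin n => f (Pi.single i 1)
  choose w hw using hb
  have hb0 : ((b : ℤ) : ℚ) ≠ 0 := by exact_mod_cast nonZeroDivisors.ne_zero b.2
  have hw' : ∀ i, (w i : ℚ) = (b : ℤ) * f (Pi.single i 1) := fun i => by
    have := hw i
    simpa [zsmul_eq_mul] using this
  -- The common denominator `b` may be negative; multiplying by it once more scales the functional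
  -- by `b ^ 2 > 0`.
  refine ⟨fun i => b * w i, fun j => ?_⟩
  have h1 : ((X.ray j ⬝ᵥ fun i => (b : ℤ) * w i : ℤ) : ℚ) =
      ((b : ℤ) : ℚ) ^ 2 * f fun i => (X.ray j i : ℚ) := by
    rw [LinearMap.pi_apply_eq_sum_univ f, Finset.mul_sum, dotProduct]
    push_cast
    refine Finset.sum_congr rfl fun i _ => ?_
    rw [hw', smul_eq_mul]
    have : (fun l => if i = l then (1 : ℚ) else 0) = Pi.single i 1 := by
      funext l
      simp [Pi.single_apply, eq_comm]
    rw [this]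
    ring
  have h2 := mul_pos (pow_pos (abs_pos.mpr hb0) 2) (hf j)
  rw [sq_abs, ← h1] at h2
  exact_mod_cast h2

theorem mem_dualMonoid_of_forall_pos {m : Fin n → ℤ} (h : ∀ j, 0 < X.ray j ⬝ᵥ m) :
    m ∈ X.dualMonoid :=
  (X.mem_dualMonoid_iff m).mpr fun j => (h j).le

/-- Both `m - m'` and its negative lie in the dual monoid, so `m - m'` vanishes on the cone, which
spans the space. This is where the absence of a torus factor makes the Cox embedding injective. -/
theorem eq_of_forall_ray_dotProduct_eq {m m' : Fin n → ℤ}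
    (h : ∀ j, X.ray j ⬝ᵥ m = X.ray j ⬝ᵥ m') : m = m' := by
  have h1 : ∀ v ∈ X.cone, (v ⬝ᵥ fun i => (((m - m') i : ℤ) : ℚ)) = 0 := by
    intro v hv
    have ha : m - m' ∈ X.dualMonoid := (X.mem_dualMonoid_iff _).mpr fun j => by
      rw [dotProduct_sub, h, sub_self]
    have hb : m' - m ∈ X.dualMonoid := (X.mem_dualMonoid_iff _).mpr fun j => by
      rw [dotProduct_sub, h, sub_self]
    have h2 := hb v hv
    have h3 : (fun i => (((m' - m) i : ℤ) : ℚ)) = -fun i => (((m - m') i : ℤ) : ℚ) := by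
      funext i
      simp
    rw [h3, dotProduct_neg] at h2
    exact le_antisymm (by linarith) (ha v hv)
  have h2 : ∀ v : Fin n → ℚ, (v ⬝ᵥ fun i => (((m - m') i : ℤ) : ℚ)) = 0 := by
    intro v
    have hv : v ∈ Submodule.span ℚ (X.cone : Set (Fin n → ℚ)) := by rw [X.full]; trivial
    induction hv using Submodule.span_induction with
    | mem v hv => exact h1 v hv
    | zero => exact zero_dotProduct _
    | add v w _ _ hv hw => rw [add_dotProduct, hv, hw, add_zero]
    | smul c v _ hv => rw [smul_dotProduct, hv, smul_zero]
  have h3 := dotProduct_eq_zero_iff.mp fun v => (dotProduct_comm _ v).trans (h2 v)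
  funext i
  have h4 := congrFun h3 i
  simp only [Pi.sub_apply, Pi.zero_apply, Int.cast_eq_zero] at h4
  exact sub_eq_zero.mp h4

variable (k : Type*) [Field k]

/-- The exponents `(⟨ρ_i, m⟩)_i` of the monomial of the Cox ring corresponding to `χ^m`. -/
noncomputable def coxExponent : X.dualMonoid →+ (Fin X.numRays →₀ ℕ) where
  toFun m := Finsupp.equivFunOnFinite.symm fun i => (X.ray i ⬝ᵥ (m : Fin n → ℤ)).toNat
  map_zero' := by
    ext i
    simp
  map_add' a b := by
    ext i
    simp only [Finsupp.coe_equivFunOnFinite_symm, Finsupp.coe_add, Pi.add_apply,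
      AddSubmonoid.coe_add, dotProduct_add]
    exact Int.toNat_add ((X.mem_dualMonoid_iff _).mp a.2 i) ((X.mem_dualMonoid_iff _).mp b.2 i)

theorem coxExponent_apply (m : X.dualMonoid) (i : Fin X.numRays) :
    (X.coxExponent m i : ℤ) = X.ray i ⬝ᵥ (m : Fin n → ℤ) :=
  Int.toNat_of_nonneg ((X.mem_dualMonoid_iff _).mp m.2 i)

/-- The embedding `𝒪(X) → k[x_1, …, x_r]`, `χ^m ↦ ∏ x_i ^ ⟨ρ_i, m⟩`. -/
noncomputable def coxEmbedding : X.CoordRing k →ₐ[k] X.CoxRing k :=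
  AddMonoidAlgebra.mapDomainAlgHom k k X.coxExponent

theorem coxEmbedding_single (m : X.dualMonoid) (c : k) :
    X.coxEmbedding k (AddMonoidAlgebra.single m c) = MvPolynomial.monomial (X.coxExponent m) c :=
  AddMonoidAlgebra.mapDomain_single

theorem coxEmbedding_injective : Function.Injective (X.coxEmbedding k) :=
  AddMonoidAlgebra.mapDomain_injective fun a b h =>
    Subtype.ext (X.eq_of_forall_ray_dotProduct_eq fun i => by
      rw [← coxExponent_apply, ← coxExponent_apply, h])

theorem coxDerivation_eq_erasedDerivation (j : Fin X.numRays) (e : Fin n → ℤ) :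
    X.coxDerivation k j e = erasedDerivation k (fun l => (X.coxRoot e l).toNat) j := rfl

theorem coxEmbedding_rootDerivation {j : Fin X.numRays} {e : Fin n → ℤ}
    (he : X.IsDemazureRoot j e) (f : X.CoordRing k) :
    X.coxEmbedding k (X.rootDerivation k he f) = X.coxDerivation k j e (X.coxEmbedding k f) := by
  induction f using AddMonoidAlgebra.induction_linear with
  | zero => simp only [map_zero]
  | add f g hf hg => simp only [map_add, hf, hg]
  | single m c =>
    rw [rootDerivation_single, coxEmbedding_single, coxDerivation_eq_erasedDerivation,
      erasedDerivation_monomial, rootValue, map_smul]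
    have hm : ((X.coxExponent m j : ℕ) : k) = ((X.ray j ⬝ᵥ (m : Fin n → ℤ) : ℤ) : k) := by
      rw [← coxExponent_apply, Int.cast_natCast]
    by_cases h0 : X.ray j ⬝ᵥ (m : Fin n → ℤ) = 0
    · rw [hm, h0, Int.cast_zero, mul_zero, map_zero]
      split_ifs <;> simp
    · rw [dif_pos (X.add_mem_dualMonoid he m.2 h0), coxEmbedding_single, MvPolynomial.smul_monomial,
        smul_eq_mul, hm]
      congr 1
      congr 1
      ext l
      have h1 := X.coxExponent_apply ⟨_, X.add_mem_dualMonoid he m.2 h0⟩ l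
      have h2 := X.coxExponent_apply m l
      rw [dotProduct_add] at h1
      by_cases hl : l = j
      · subst hl
        simp only [Finsupp.coe_add, Pi.add_apply, Finsupp.coe_equivFunOnFinite_symm,
          Function.update_self, Finsupp.coe_tsub, Pi.sub_apply, Finsupp.single_eq_same]
        have := he.1
        omega
      · simp only [Finsupp.coe_add, Pi.add_apply, Finsupp.coe_equivFunOnFinite_symm,
          Function.update_of_ne hl, Finsupp.coe_tsub, Pi.sub_apply, Finsupp.single_eq_of_ne hl,
          coxRoot]
        have := he.2 l hl
        omega

/-- The linear form `⟨ρ_j, ·⟩`. -/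
def rayForm (j : Fin X.numRays) : (Fin n → ℤ) →+ ℤ where
  toFun m := X.ray j ⬝ᵥ m
  map_zero' := dotProduct_zero _
  map_add' := dotProduct_add _

/-- The embedding of `𝒪(X)` into the coordinate algebra of the torus. -/
noncomputable def torusEmbedding : X.CoordRing k →ₗ[k] AddMonoidAlgebra k (Fin n → ℤ) :=
  AddMonoidAlgebra.mapDomainLinearMap k k fun m : X.dualMonoid => (m : Fin n → ℤ)

theorem torusEmbedding_single (m : X.dualMonoid) (c : k) :
    X.torusEmbedding k (AddMonoidAlgebra.single m c) = AddMonoidAlgebra.single (m : Fin n → ℤ) c :=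
  AddMonoidAlgebra.mapDomainLinearMap_single _ _ _

theorem torusEmbedding_injective : Function.Injective (X.torusEmbedding k) :=
  AddMonoidAlgebra.mapDomain_injective Subtype.val_injective

theorem actsAsMonomial_rootDerivation {j : Fin X.numRays} {e : Fin n → ℤ}
    (he : X.IsDemazureRoot j e) :
    ActsAsMonomial (X.torusEmbedding k) (X.rootDerivation k he) e (X.rayForm j) := by
  intro f
  induction f using AddMonoidAlgebra.induction_linear with
  | zero => simp only [map_zero]
  | add f g hf hg => simp only [map_add, hf, hg]
  | single m c =>
    rw [rootDerivation_single, torusEmbedding_single, monomialOperator_single, rootValue, map_smul]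
    by_cases h0 : X.ray j ⬝ᵥ (m : Fin n → ℤ) = 0
    · have h1 : X.rayForm j m = 0 := h0
      rw [h1, h0]
      split_ifs <;> simp
    · rw [dif_pos (X.add_mem_dualMonoid he m.2 h0), torusEmbedding_single,
        AddMonoidAlgebra.smul_single]
      rfl

variable [CharZero k]

variable {j₁ j₂ : Fin X.numRays} {e₁ e₂ : Fin n → ℤ}

theorem isUnipotentAlgebraicGroup_coxDerivation (hj : j₁ ≠ j₂) (h : X.ray j₁ ⬝ᵥ e₂ = 0) :
    IsUnipotentAlgebraicGroup
      (groupGenerated (X.coxDerivation k j₁ e₁) (X.coxDerivation k j₂ e₂)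
        (X.isLocallyNilpotent_coxDerivation k j₁ e₁) (X.isLocallyNilpotent_coxDerivation k j₂ e₂)) :=
  isUnipotentAlgebraicGroup_erasedDerivation (a := fun l => (X.coxRoot e₁ l).toNat)
    (b := fun l => (X.coxRoot e₂ l).toNat) _ _ hj (by simp only [coxRoot, h, Int.toNat_zero])

/-- The Cox embedding intertwines the derivations, so the Cox group restricts to `𝒪(X)`. The
restriction is faithful: `𝒪(X)` contains a monomial with all Cox exponents positive, and only the
identity of the Cox group fixes it. -/
theorem isUnipotentAlgebraicGroup_rootDerivation (hj : j₁ ≠ j₂) (he₁ : X.IsDemazureRoot j₁ e₁)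
    (he₂ : X.IsDemazureRoot j₂ e₂) (h : X.ray j₁ ⬝ᵥ e₂ = 0) :
    IsUnipotentAlgebraicGroup
      (groupGenerated (X.rootDerivation k he₁) (X.rootDerivation k he₂)
        (X.isLocallyNilpotent_rootDerivation k he₁)
        (X.isLocallyNilpotent_rootDerivation k he₂)) := by
  refine IsUnipotentAlgebraicGroup.groupGenerated_of_semiconj (X.coxEmbedding_injective k)
    (X.coxEmbedding_rootDerivation k he₁) (X.coxEmbedding_rootDerivation k he₂) _ _ _ _
    (X.isUnipotentAlgebraicGroup_coxDerivation k hj h) fun g hg hfix => ?_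
  obtain ⟨m, hm⟩ := X.exists_forall_ray_dotProduct_pos
  let m' : X.dualMonoid := ⟨m, X.mem_dualMonoid_of_forall_pos hm⟩
  have hpos : ∀ i, X.coxExponent m' i ≠ 0 := fun i h0 => by
    have := X.coxExponent_apply m' i
    rw [h0] at this
    exact (hm i).ne this
  have hfix' := hfix (AddMonoidAlgebra.single m' 1)
  rw [coxEmbedding_single, MvPolynomial.monomial_eq, map_one, one_mul,
    Finsupp.prod_fintype _ _ fun _ => pow_zero _] at hfix'
  exact eq_one_of_apply_monomial_eq (a := fun l => (X.coxRoot e₁ l).toNat)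
    (b := fun l => (X.coxRoot e₂ l).toNat) _ _ hj (by simp only [coxRoot, h, Int.toNat_zero]) hg
    (hpos j₁) (hpos j₂) hfix'

end ToricCone

end RootSubgroups

theorem mainTheorem7 {k : Type*} [Field k] [IsAlgClosed k] [CharZero k] {n : ℕ}
    (X : RootSubgroups.ToricCone n) (j₁ j₂ : Fin X.numRays) (hj : j₁ ≠ j₂) (e₁ e₂ : Fin n → ℤ)
    (he₁ : X.IsDemazureRoot j₁ e₁) (he₂ : X.IsDemazureRoot j₂ e₂) :
    List.TFAE [
      RootSubgroups.IsUnipotentAlgebraicGroup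
        (RootSubgroups.groupGenerated (X.coxDerivation k j₁ e₁) (X.coxDerivation k j₂ e₂)
          (X.isLocallyNilpotent_coxDerivation k j₁ e₁)
          (X.isLocallyNilpotent_coxDerivation k j₂ e₂)),
      FiniteDimensional k
          (RootSubgroups.lieGenerated (X.coxDerivation k j₁ e₁) (X.coxDerivation k j₂ e₂)) ∧
        LieRing.IsNilpotent
          (RootSubgroups.lieGenerated (X.coxDerivation k j₁ e₁) (X.coxDerivation k j₂ e₂)),
      min (dotProduct (Pi.single j₁ 1) (X.coxRoot e₂))
        (dotProduct (Pi.single j₂ 1) (X.coxRoot e₁)) = 0] ∧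
    List.TFAE [
      RootSubgroups.IsUnipotentAlgebraicGroup
        (RootSubgroups.groupGenerated (X.rootDerivation k he₁) (X.rootDerivation k he₂)
          (X.isLocallyNilpotent_rootDerivation k he₁)
          (X.isLocallyNilpotent_rootDerivation k he₂)),
      FiniteDimensional k
          (RootSubgroups.lieGenerated (X.rootDerivation k he₁) (X.rootDerivation k he₂)) ∧
        LieRing.IsNilpotent
          (RootSubgroups.lieGenerated (X.rootDerivation k he₁) (X.rootDerivation k he₂)),
      min (dotProduct (X.ray j₁) e₂) (dotProduct (X.ray j₂) e₁) = 0] := by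
  have h12 : 0 ≤ dotProduct (X.ray j₁) e₂ := he₂.2 j₁ hj
  have h21 : 0 ≤ dotProduct (X.ray j₂) e₁ := he₁.2 j₂ hj.symm
  constructor
  -- In the Cox ring the linear forms are the coordinate functions and the test monomial is the
  -- product of all variables.
  · have H := RootSubgroups.tfae_of_actsAsMonomial (k := k) RootSubgroups.toLaurent_injective
      (RootSubgroups.actsAsMonomial_erasedDerivation (fun l => (X.coxRoot e₁ l).toNat) j₁)
      (RootSubgroups.actsAsMonomial_erasedDerivation (fun l => (X.coxRoot e₂ l).toNat) j₂)
      (m := fun _ => 1)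
    have v12 : Pi.evalAddMonoidHom (fun _ => ℤ) j₁
        (Function.update (fun l => ((X.coxRoot e₂ l).toNat : ℤ)) j₂ (-1)) =
          dotProduct (X.ray j₁) e₂ := by
      rw [Pi.evalAddMonoidHom_apply, Function.update_of_ne hj]
      exact Int.toNat_of_nonneg h12
    have v21 : Pi.evalAddMonoidHom (fun _ => ℤ) j₂
        (Function.update (fun l => ((X.coxRoot e₁ l).toNat : ℤ)) j₁ (-1)) =
          dotProduct (X.ray j₂) e₁ := by
      rw [Pi.evalAddMonoidHom_apply, Function.update_of_ne hj.symm]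
      exact Int.toNat_of_nonneg h21
    rw [v12, v21] at H
    rw [single_one_dotProduct, single_one_dotProduct]
    refine H (by rw [Pi.evalAddMonoidHom_apply, Function.update_self])
      (by rw [Pi.evalAddMonoidHom_apply, Function.update_self]) h12 h21
      ⟨MvPolynomial.monomial (Finsupp.equivFunOnFinite.symm fun _ => 1) 1, ?_⟩ one_pos one_pos
      (X.isLocallyNilpotent_coxDerivation k j₁ e₁) (X.isLocallyNilpotent_coxDerivation k j₂ e₂)
      (fun h => X.isUnipotentAlgebraicGroup_coxDerivation k hj h)
      (fun h => X.isUnipotentAlgebraicGroup_coxDerivation k hj.symm h)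
    rw [RootSubgroups.toLaurent_monomial]
    simp
  · obtain ⟨m, hm⟩ := X.exists_forall_ray_dotProduct_pos
    exact RootSubgroups.tfae_of_actsAsMonomial (X.torusEmbedding_injective k)
      (X.actsAsMonomial_rootDerivation k he₁) (X.actsAsMonomial_rootDerivation k he₂) he₁.1 he₂.1
      h12 h21 ⟨_, X.torusEmbedding_single k ⟨m, X.mem_dualMonoid_of_forall_pos hm⟩ 1⟩ (hm j₁) (hm j₂)
      _ _ (fun h => X.isUnipotentAlgebraicGroup_rootDerivation k hj he₁ he₂ h)
      (fun h => X.isUnipotentAlgebraicGroup_rootDerivation k hj.symm he₂ he₁ h)
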